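/- Let $\mathcal H,\mathcal G$ be real Hilbert spaces, let $f:\mathcal H\to[-\infty,+\infty]$ and $g:\mathcal G\to[-\infty,+\infty]$ be proper, convex and lower semicontinuous, let $h:\mathcal H\to\mathbb R$ be convex and Fréchet differentiable with $L_h$-Lipschitz continuous gradient ($L_h\ge 0$), and let $A:\mathcal H\to\mathcal G$ be a continuous linear operator. Let $c>0$ and $\gamma\in[0,1]$. For a real Hilbert space $E$ let $S_+(E)$ be the set of self-adjoint positive semidefinite continuous linear operators on $E$, write $U_1\succcurlyeq U_2$ if $\langle x,U_1x\rangle\ge\langle x,U_2x\rangle$ for all $x\in E$, and for $\alpha>0$ let $P_\alpha(E)=\{U\in S_+(E): U\succcurlyeq\alpha I\}$. A function $u$ from $[0,+\infty)$ to a Banach space is locally absolutely continuous if for every $T>0$ there is a (Bochner) integrable $v$ on $[0,T]$ with $u(t)=u(0)+\int_0^t v(s)\,ds$ for all $t\in[0,T]$. A saddle point of the Lagrangian $$l(x,z,y)=f(x)+h(x)+g(z)+\langle y,Ax-z\rangle ,\qquad (x,z,y)\in\mathcal H\times\mathcal G\times\mathcal G,$$ is a point $(x^*,z^*,y^*)$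 with $l(x^*,z^*,y)\le l(x^*,z^*,y^*)\le l(x,z,y^*)$ for all $(x,z,y)\in\mathcal H\times\mathcal G\times\mathcal G$. Given $M_1:[0,+\infty)\to S_+(\mathcal H)$, $M_2:[0,+\infty)\to S_+(\mathcal G)$ and $(x^0,z^0,y^0)\in\mathcal H\times\mathcal G\times\mathcal G$, a strong global solution of the primal-dual dynamical system is a triple of locally absolutely continuous functions $x:[0,+\infty)\to\mathcal H$ and $z,y:[0,+\infty)\to\mathcal G$ with $x(0)=x^0$, $z(0)=z^0$, $y(0)=y^0$ and, for almost every $t\ge0$, $$\dot x(t)+x(t)\in(\partial f+cA^*A+M_1(t))^{-1}\big(M_1(t)x(t)+cA^*z(t)-A^*y(t)-\nabla h(x(t))\big),$$ $$\dot z(t)+z(t)\in(\partial g+cI+M_2(t))^{-1}\big(M_2(t)z(t)+cA(\gamma\dot x(t)+x(t))+y(t)\big),$$ $$\dot y(t)=cA(x(t)+\dot x(t))-c(z(t)+\dot z(t)),$$ where $\partial$ is the convex subdifferential. **Theorem.** Assume that $l$ has a saddle point; that $M_1$ and $M_2$ are locally absolutely continuous with respect to the operator norm and monotonically decreasing (that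 is, $M_i(t_1)\succcurlyeq M_i(t_2)$ whenever $0\le t_1\le t_2$); that $$M_1(t)+\frac{c(1-\gamma)}4A^*A-\frac{L_h}4I\in S_+(\mathcal H)\qquad\text{for all }t\ge0;$$ and that the derivatives $\dot M_1,\dot M_2$, which exist almost everywhere, are bounded in operator norm. Assume moreover that one of the following holds: (I) there is $\alpha>0$ with $M_1(t)+\frac{c(1-\gamma)}4A^*A-\frac{L_h}4I\in P_\alpha(\mathcal H)$ for all $t\ge0$; (II) $\gamma\in[0,1)$ and there is $\alpha>0$ with $A^*A\in P_\alpha(\mathcal H)$. Then, for every starting point $(x^0,z^0,y^0)$, every strong global solution $(x,z,y)$ of the system converges weakly in $\mathcal H\times\mathcal G\times\mathcal G$ to a saddle point of $l$ as $t\to+\infty$. -/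

import Mathlib

open Set Filter Topology MeasureTheory
open scoped Pointwise Gradient

namespace PrimalDual

variable {E H G : Type*}

/-- `f : E → [-∞, +∞]` is proper (never `-∞`, not identically `+∞`), convex (its epigraph is a
convex set) and lower semicontinuous. -/
structure IsProperConvexLSC [NormedAddCommGroup E] [InnerProductSpace ℝ E] (f : E → EReal) :
    Prop where
  ne_bot : ∀ x, f x ≠ ⊥
  exists_ne_top : ∃ x, f x ≠ ⊤
  convex_epigraph : Convex ℝ {p : E × ℝ | f p.1 ≤ (p.2 : EReal)}
  lowerSemicontinuous : LowerSemicontinuous f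

/-- The convex subdifferential
`∂f(x) = {u | f(x') - f(x) ≥ ⟨u, x' - x⟩ for all x'}` if `f(x) ∈ ℝ`, and `∅` otherwise. -/
def subdifferential [NormedAddCommGroup E] [InnerProductSpace ℝ E] (f : E → EReal) (x : E) :
    Set E :=
  {u | f x ≠ ⊥ ∧ f x ≠ ⊤ ∧ ∀ x' : E, f x + ((inner ℝ u (x' - x) : ℝ) : EReal) ≤ f x'}

/-- The inverse of a set-valued operator: `u ∈ T⁻¹(v)` iff `v ∈ T(u)`. -/
def setValuedInverse (T : E → Set E) (v : E) : Set E := {u | v ∈ T u}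

/-- The order `U₁ ≽ U₂`, i.e. `⟨x, U₁ x⟩ ≥ ⟨x, U₂ x⟩` for all `x`. -/
def OpGE [NormedAddCommGroup E] [InnerProductSpace ℝ E] (U₁ U₂ : E →L[ℝ] E) : Prop :=
  ∀ x : E, inner ℝ x (U₂ x) ≤ inner ℝ x (U₁ x)

/-- `S₊(E)`: the continuous linear operators that are self-adjoint and positive semidefinite. -/
def SPlus (E : Type*) [NormedAddCommGroup E] [InnerProductSpace ℝ E] : Set (E →L[ℝ] E) :=
  {U | U.IsPositive}

/-- `P_α(E) = {U ∈ S₊(E) | U ≽ α I}`. -/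
def PAlpha (E : Type*) [NormedAddCommGroup E] [InnerProductSpace ℝ E] (α : ℝ) :
    Set (E →L[ℝ] E) :=
  {U | U ∈ SPlus E ∧ OpGE U (α • ContinuousLinearMap.id ℝ E)}

/-- `M : [0,∞) → L(E)` is monotonically decreasing: `M(t₁) ≽ M(t₂)` whenever `0 ≤ t₁ ≤ t₂`. -/
def OpDecreasing [NormedAddCommGroup E] [InnerProductSpace ℝ E] (M : ℝ → E →L[ℝ] E) : Prop :=
  ∀ t₁ t₂ : ℝ, 0 ≤ t₁ → t₁ ≤ t₂ → OpGE (M t₁) (M t₂)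

/-- Local absolute continuity on `[0,∞)`: on every `[0,T]`, the function is the (Bochner) integral
of an integrable function. Only the values of `u` on `[0,∞)` matter. -/
def LocAbsCont [NormedAddCommGroup E] [NormedSpace ℝ E] (u : ℝ → E) : Prop :=
  ∀ T : ℝ, 0 < T → ∃ v : ℝ → E, IntegrableOn v (Icc 0 T) ∧
    ∀ t ∈ Icc (0 : ℝ) T, u t = u 0 + ∫ s in (0 : ℝ)..t, v s

/-- The derivative is bounded on `[0,∞)`. A locally absolutely continuous function has a derivative
at almost every point only, so the bound is required at almost every point; for operator-valued
functions the derivative is taken in the operator norm. -/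
def BoundedDeriv [NormedAddCommGroup E] [NormedSpace ℝ E] (u : ℝ → E) : Prop :=
  ∃ K : ℝ, ∀ᵐ t ∂(volume.restrict (Ici (0 : ℝ))), ‖deriv u t‖ ≤ K

variable [NormedAddCommGroup H] [InnerProductSpace ℝ H] [NormedAddCommGroup G]
  [InnerProductSpace ℝ G]

/-- The Lagrangian `l(x,z,y) = f(x) + h(x) + g(z) + ⟨y, Ax - z⟩`. -/
noncomputable def lagrangian (f : H → EReal) (h : H → ℝ) (g : G → EReal) (A : H →L[ℝ] G)
    (x : H) (z y : G) : EReal :=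
  f x + (h x : EReal) + g z + ((inner ℝ y (A x - z) : ℝ) : EReal)

/-- `(x,z,y)` is a saddle point of the Lagrangian. -/
def IsSaddlePoint (f : H → EReal) (h : H → ℝ) (g : G → EReal) (A : H →L[ℝ] G)
    (x : H) (z y : G) : Prop :=
  (∀ y' : G, lagrangian f h g A x z y' ≤ lagrangian f h g A x z y) ∧
    ∀ (x' : H) (z' : G), lagrangian f h g A x z y ≤ lagrangian f h g A x' z' y

variable [CompleteSpace H] [CompleteSpace G]

/-- `(x,z,y)` is a strong global solution of the primal-dual dynamical system
`x' + x ∈ (∂f + c A*A + M₁(t))⁻¹ (M₁(t) x + c A* z - A* y - ∇h(x))`,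
`z' + z ∈ (∂g + c I + M₂(t))⁻¹ (M₂(t) z + c A(γ x' + x) + y)`,
`y' = c A(x + x') - c (z + z')`, with starting point `(x₀,z₀,y₀)`. -/
structure IsStrongGlobalSolution (f : H → EReal) (h : H → ℝ) (g : G → EReal) (A : H →L[ℝ] G)
    (c γ : ℝ) (M₁ : ℝ → H →L[ℝ] H) (M₂ : ℝ → G →L[ℝ] G) (x₀ : H) (z₀ y₀ : G)
    (x : ℝ → H) (z y : ℝ → G) : Prop where
  locAbsCont_x : LocAbsCont x
  locAbsCont_z : LocAbsCont z
  locAbsCont_y : LocAbsCont y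
  eq_x : ∀ᵐ t ∂(volume.restrict (Ici (0 : ℝ))),
    deriv x t + x t ∈
      setValuedInverse
        (fun u => subdifferential f u + {c • ContinuousLinearMap.adjoint A (A u) + M₁ t u})
        (M₁ t (x t) + c • ContinuousLinearMap.adjoint A (z t)
          - ContinuousLinearMap.adjoint A (y t) - ∇ h (x t))
  eq_z : ∀ᵐ t ∂(volume.restrict (Ici (0 : ℝ))),
    deriv z t + z t ∈
      setValuedInverse
        (fun u => subdifferential g u + {c • u + M₂ t u})
        (M₂ t (z t) + c • A (γ • deriv x t + x t) + y t)
  eq_y : ∀ᵐ t ∂(volume.restrict (Ici (0 : ℝ))),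
    deriv y t = c • A (x t + deriv x t) - c • (z t + deriv z t)
  init_x : x 0 = x₀
  init_z : z 0 = z₀
  init_y : y 0 = y₀

end PrimalDual

/-! The proof is a Lyapunov argument followed by an Opial argument. For a saddle point (x*, z*, y*),
`energy` is the sum of ⟨x - x*, (M₁ + c(1-γ)A*A)(x - x*)⟩, ⟨z - z*, (M₂ + cI)(z - z*)⟩ and c⁻¹‖y -
y*‖². Its derivative involves dM₁/dt and dM₂/dt only through nonpositive terms. Monotonicity of ∂f
and ∂g, together with a Baillon–Haddad inequality for ∇h, bounds the rest by minus a quadratic form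
in the velocities (`dissipation_inequality`, `ae_dissipation_le_neg_deriv_energy`). The x-part of
this form is M₁ + (c(1-γ)/2)A*A - (L/4)I, which both (I) and (II) make uniformly coercive. Hence the
energy decreases to a limit and the trajectory is bounded.

Every unit interval [t, t+1] contains a time s at which the inclusions hold and the velocities are
controlled by the energy drop over the interval; that drop tends to 0, and the trajectory moves
little between t and s. Weak cluster points therefore solve the optimality system
(`isSaddlePoint_of_dissipation`).

For two cluster points, the difference of their energies converges. Since decreasing positive
operators converge strongly, its limit can be computed along each of the two filters, and comparing
the results forces the points to coincide (`exists_limit_quadEnergy_sub`). Ultrafilters replace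
subsequences throughout. -/

namespace PrimalDual

/-! ### Locally absolutely continuous functions and integrated dissipation. -/

section AbsolutelyContinuous

open AbsolutelyContinuousOnInterval

variable {E F K : Type*} [NormedAddCommGroup E] [NormedSpace ℝ E] [NormedAddCommGroup F]
  [NormedSpace ℝ F] [NormedAddCommGroup K] [NormedSpace ℝ K]

theorem _root_.AbsolutelyContinuousOnInterval.bilinear (B : E →L[ℝ] F →L[ℝ] K)
    {u : ℝ → E} {v : ℝ → F} {a b : ℝ} (hu : AbsolutelyContinuousOnInterval u a b)
    (hv : AbsolutelyContinuousOnInterval v a b) :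
    AbsolutelyContinuousOnInterval (fun t => B (u t) (v t)) a b := by
  obtain ⟨C, hC⟩ := hu.exists_bound
  obtain ⟨D, hD⟩ := hv.exists_bound
  unfold AbsolutelyContinuousOnInterval at hu hv
  apply squeeze_zero' ?_ ?_
    (by simpa using (hv.const_mul (‖B‖ * C)).add (hu.const_mul (‖B‖ * D)))
  · exact Filter.Eventually.of_forall <| fun _ ↦ Finset.sum_nonneg (fun i hi ↦ dist_nonneg)
  rw [eventually_inf_principal]
  filter_upwards with (n, I) hnI
  simp only [Finset.mul_sum, ← Finset.sum_add_distrib]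
  refine Finset.sum_le_sum fun i hi => ?_
  simp only [disjWithin, mem_ofPred_eq] at hnI
  have h1 := hC _ (hnI.left i hi).left
  have h2 := hD _ (hnI.left i hi).right
  generalize (I i).1 = p at *
  generalize (I i).2 = q at *
  have e : B (u p) (v p) - B (u q) (v q) = B (u p) (v p - v q) + B (u p - u q) (v q) := by
    simp
  simp only [dist_eq_norm, e]
  refine (norm_add_le _ _).trans (add_le_add ?_ ?_)
  · refine (B.le_opNorm₂ _ _).trans ?_
    gcongr
  · refine (B.le_opNorm₂ _ _).trans ?_
    rw [mul_right_comm]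
    gcongr

/-- Increments of u are dominated by increments of the real function t ↦ ∫₀ᵗ ‖v‖, which is
absolutely continuous. -/
theorem LocAbsCont.absolutelyContinuousOnInterval {u : ℝ → E} (hu : LocAbsCont u) {T : ℝ}
    (hT : 0 < T) : AbsolutelyContinuousOnInterval u 0 T := by
  obtain ⟨v, hv, huv⟩ := hu T hT
  have hvi : IntervalIntegrable v volume 0 T :=
    (intervalIntegrable_iff_integrableOn_Icc_of_le hT.le).2 hv
  have hV := hvi.norm.absolutelyContinuousOnInterval_intervalIntegral (c := 0) (by simp)
  unfold AbsolutelyContinuousOnInterval at hV ⊢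
  refine squeeze_zero' (Eventually.of_forall fun _ => Finset.sum_nonneg fun i _ => dist_nonneg)
    ?_ hV
  rw [eventually_inf_principal]
  filter_upwards with (n, I) hnI
  refine Finset.sum_le_sum fun i hi => ?_
  simp only [disjWithin, mem_ofPred_eq] at hnI
  obtain ⟨h1, h2⟩ := hnI.left i hi
  rw [uIcc_of_le hT.le] at h1 h2
  have hsub : ∀ {p}, p ∈ Icc 0 T → IntervalIntegrable v volume 0 p := fun {p} hp =>
    hvi.mono_set (by rw [uIcc_of_le hT.le, uIcc_of_le hp.1]; exact Icc_subset_Icc_right hp.2)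
  rw [dist_eq_norm, dist_eq_norm, huv _ h1, huv _ h2, add_sub_add_left_eq_sub,
    intervalIntegral.integral_interval_sub_left (hsub h1) (hsub h2),
    intervalIntegral.integral_interval_sub_left (hsub h1).norm (hsub h2).norm]
  exact intervalIntegral.norm_integral_le_abs_integral_norm

theorem LocAbsCont.ae_hasDerivAt [CompleteSpace E] {u : ℝ → E} (hu : LocAbsCont u) :
    ∀ᵐ t ∂(volume.restrict (Ici (0 : ℝ))), HasDerivAt u (deriv u t) t := by
  have key : ∀ n : ℕ, ∀ᵐ t : ℝ, t ∈ Ioo (0 : ℝ) (n + 1) → HasDerivAt u (deriv u t) t := by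
    intro n
    have hT : (0 : ℝ) < n + 1 := by positivity
    obtain ⟨v, hv, huv⟩ := hu (n + 1) hT
    have hvi : IntervalIntegrable v volume 0 (n + 1) :=
      (intervalIntegrable_iff_integrableOn_Icc_of_le hT.le).2 hv
    filter_upwards [hvi.ae_hasDerivAt_integral] with t ht hmem
    rw [uIcc_of_le hT.le] at ht
    have h1 := (ht (Ioo_subset_Icc_self hmem) 0 ⟨le_rfl, hT.le⟩).const_add (u 0)
    refine (h1.congr_of_eventuallyEq ?_).differentiableAt.hasDerivAt
    filter_upwards [Ioo_mem_nhds hmem.1 hmem.2] with s hs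
    exact huv s (Ioo_subset_Icc_self hs)
  rw [ae_restrict_iff' measurableSet_Ici]
  -- The point 0 is discarded: the derivative there would involve the unconstrained values of u on
  -- the negative axis.
  have h0 : ∀ᵐ t : ℝ, t ≠ 0 := by simp [ae_iff, measure_singleton]
  filter_upwards [ae_all_iff.2 key, h0] with t ht ht0 hmem
  obtain ⟨n, hn⟩ := exists_nat_gt t
  exact ht n ⟨lt_of_le_of_ne hmem (Ne.symm ht0), by linarith⟩

theorem LocAbsCont.intervalIntegrable_deriv [CompleteSpace E] {u : ℝ → E} (hu : LocAbsCont u)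
    {a b : ℝ} (ha : 0 ≤ a) (hab : a ≤ b) :
    IntervalIntegrable (deriv u) volume a b ∧ u b - u a = ∫ t in a..b, deriv u t := by
  have hT : (0 : ℝ) < b + 1 := by linarith
  obtain ⟨v, hv, huv⟩ := hu (b + 1) hT
  have hvi : IntervalIntegrable v volume 0 (b + 1) :=
    (intervalIntegrable_iff_integrableOn_Icc_of_le hT.le).2 hv
  have hsub : ∀ {p q}, 0 ≤ p → p ≤ q → q ≤ b → IntervalIntegrable v volume p q :=
    fun {p q} hp hpq hq => hvi.mono_set (by
      rw [uIcc_of_le hT.le, uIcc_of_le hpq]; exact Icc_subset_Icc hp (by linarith))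
  have hae : ∀ᵐ t : ℝ, t ∈ Ioc a b → v t = deriv u t := by
    filter_upwards [hvi.ae_hasDerivAt_integral] with t ht hmem
    rw [uIcc_of_le hT.le] at ht
    have hm : t ∈ Ioo 0 (b + 1) := ⟨ha.trans_lt hmem.1, by linarith [hmem.2]⟩
    have h1 := (ht (Ioo_subset_Icc_self hm) 0 ⟨le_rfl, hT.le⟩).const_add (u 0)
    refine ((h1.congr_of_eventuallyEq ?_).deriv).symm
    filter_upwards [Ioo_mem_nhds hm.1 hm.2] with s hs
    exact huv s (Ioo_subset_Icc_self hs)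
  constructor
  · refine (hsub ha hab le_rfl).congr_ae ?_
    rw [uIoc_of_le hab]
    exact (ae_restrict_iff' measurableSet_Ioc).2 hae
  · rw [huv b ⟨by linarith, by linarith⟩, huv a ⟨ha, by linarith⟩, add_sub_add_left_eq_sub,
      intervalIntegral.integral_interval_sub_left (hsub le_rfl (ha.trans hab) le_rfl)
        (hsub le_rfl ha hab)]
    refine intervalIntegral.integral_congr_ae ?_
    rwa [uIoc_of_le hab]

/-- A dissipation inequality `δ ‖u'‖² ≤ -W'` controls the increments of `u` on intervals of length
at most one. -/
theorem LocAbsCont.norm_sub_sq_le [CompleteSpace E] {u : ℝ → E} (hu : LocAbsCont u) {W : ℝ → ℝ}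
    {δ : ℝ} (hδ : 0 < δ)
    (hW : ∀ᵐ t ∂(volume.restrict (Ici (0 : ℝ))), δ * ‖deriv u t‖ ^ 2 ≤ -deriv W t)
    {a b : ℝ} (ha : 0 ≤ a) (hab : a ≤ b) (hba : b ≤ a + 1)
    (hWac : AbsolutelyContinuousOnInterval W a b) :
    δ * ‖u b - u a‖ ^ 2 ≤ W a - W b := by
  obtain ⟨hi, he⟩ := hu.intervalIntegrable_deriv ha hab
  set r := ‖u b - u a‖ with hr
  have hWi := hWac.intervalIntegrable_deriv
  have hWe := hWac.integral_deriv_eq_sub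
  have h1 : r ≤ ∫ t in a..b, ‖deriv u t‖ := by
    rw [hr, he]; exact intervalIntegral.norm_integral_le_integral_norm hab
  -- This is 2r‖u'‖ ≤ r² + ‖u'‖² with the constant r, so square integrability of u' is not needed.
  -- As b - a ≤ 1, the term δr² on the right absorbs only half of 2δr².
  have h2 : ∫ t in a..b, (2 * δ * r) * ‖deriv u t‖ ≤ ∫ t in a..b, (δ * r ^ 2 - deriv W t) := by
    refine intervalIntegral.integral_mono_ae_restrict hab (hi.norm.const_mul _)
      (intervalIntegrable_const.sub hWi) ?_
    filter_upwards [ae_restrict_of_ae_restrict_of_subset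
      (show Icc a b ⊆ Ici 0 from fun t ht => ha.trans ht.1) hW] with t ht
    nlinarith [mul_nonneg hδ.le (sq_nonneg (r - ‖deriv u t‖))]
  rw [intervalIntegral.integral_const_mul,
    intervalIntegral.integral_sub intervalIntegrable_const hWi, hWe,
    intervalIntegral.integral_const, smul_eq_mul] at h2
  have hr0 : 0 ≤ r := norm_nonneg _
  have h3 : 2 * δ * r * r ≤ 2 * δ * r * ∫ t in a..b, ‖deriv u t‖ := by gcongr
  have h4 : (b - a) * (δ * r ^ 2) ≤ 1 * (δ * r ^ 2) := by gcongr; linarith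
  nlinarith

/-- A function is at most its mean somewhere outside any given null set, and the mean of -W' over a
unit interval is the drop of W. -/
theorem exists_mem_Icc_neg_deriv_le {W : ℝ → ℝ} {P : ℝ → Prop}
    (hP : ∀ᵐ t ∂(volume.restrict (Ici (0 : ℝ))), P t) {a : ℝ} (ha : 0 ≤ a)
    (hWac : AbsolutelyContinuousOnInterval W a (a + 1)) :
    ∃ s ∈ Icc a (a + 1), P s ∧ -deriv W s ≤ W a - W (a + 1) := by
  have hWi := hWac.intervalIntegrable_deriv
  have hWe := hWac.integral_deriv_eq_sub
  have hle : a ≤ a + 1 := by linarith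
  have hprob : IsProbabilityMeasure (volume.restrict (Ioc a (a + 1))) :=
    ⟨by simp⟩
  have hi : Integrable (fun s => -deriv W s) (volume.restrict (Ioc a (a + 1))) :=
    ((intervalIntegrable_iff_integrableOn_Ioc_of_le hle).1 hWi).neg
  have hQ : ∀ᵐ t ∂(volume.restrict (Ioc a (a + 1))), t ∈ Ioc a (a + 1) ∧ P t :=
    (ae_restrict_mem measurableSet_Ioc).and (ae_restrict_of_ae_restrict_of_subset
      (fun t ht => ha.trans ht.1.le) hP)
  obtain ⟨s, hs, hs'⟩ := exists_notMem_null_le_integral hi (ae_iff.1 hQ)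
  simp only [mem_ofPred_eq, not_not] at hs
  refine ⟨s, Ioc_subset_Icc_self hs.1, hs.2, ?_⟩
  rw [integral_neg, ← intervalIntegral.integral_of_le hle, hWe] at hs'
  linarith

theorem antitoneOn_of_ae_deriv_nonpos {W : ℝ → ℝ}
    (hWac : ∀ T, 0 < T → AbsolutelyContinuousOnInterval W 0 T)
    (hW : ∀ᵐ t ∂(volume.restrict (Ici (0 : ℝ))), deriv W t ≤ 0) : AntitoneOn W (Ici 0) := by
  intro a ha b hb hab
  simp only [mem_Ici] at ha hb
  have hac : AbsolutelyContinuousOnInterval W a b := (hWac (b + 1) (by linarith)).mono (by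
    rw [uIcc_of_le hab, uIcc_of_le (by linarith)]; exact Icc_subset_Icc ha (by linarith))
  have h1 : ∫ t in a..b, deriv W t ≤ ∫ t in a..b, (0 : ℝ) := by
    refine intervalIntegral.integral_mono_ae_restrict hab hac.intervalIntegrable_deriv
      intervalIntegrable_const ?_
    exact ae_restrict_of_ae_restrict_of_subset
      (show Icc a b ⊆ Ici 0 from fun t ht => ha.trans ht.1) hW
  rw [hac.integral_deriv_eq_sub] at h1
  simp at h1
  linarith

end AbsolutelyContinuous

/-! ### Convex functions with Lipschitz gradient. -/

section SmoothConvex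

variable {E : Type*} [NormedAddCommGroup E] [InnerProductSpace ℝ E]

theorem hasDerivAt_le_of_forall_sub_le {φ : ℝ → ℝ} {m k : ℝ} (hφ : HasDerivAt φ m 0)
    (h : ∀ r, 0 < r → r ≤ 1 → φ r - φ 0 ≤ r * k) : m ≤ k := by
  have h1 := (hasDerivAt_iff_tendsto_slope_zero.1 hφ).mono_left
    (nhdsGT_le_nhdsNE (0 : ℝ))
  refine le_of_tendsto h1 ?_
  filter_upwards [Ioc_mem_nhdsGT (zero_lt_one (α := ℝ))] with r hr
  rw [zero_add, smul_eq_mul, inv_mul_le_iff₀ hr.1]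
  exact h r hr.1 hr.2

variable [CompleteSpace E]

theorem hasDerivAt_line {h : E → ℝ} (hdiff : Differentiable ℝ h) (u d : E) (t : ℝ) :
    HasDerivAt (fun r : ℝ => h (u + r • d)) (inner ℝ (∇ h (u + t • d)) d) t := by
  have h1 : HasDerivAt (fun r : ℝ => u + r • d) d t := by
    simpa using ((hasDerivAt_id t).smul_const d).const_add u
  have h2 := (hdiff (u + t • d)).hasGradientAt.hasFDerivAt.comp_hasDerivAt t h1
  simpa using! h2

theorem add_inner_gradient_le {h : E → ℝ} (hconv : ConvexOn ℝ Set.univ h)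
    (hdiff : Differentiable ℝ h) (u v : E) : h u + inner ℝ (∇ h u) (v - u) ≤ h v := by
  have h1 := hasDerivAt_line hdiff u (v - u) 0
  simp only [zero_smul, add_zero] at h1
  have h2 := hasDerivAt_le_of_forall_sub_le (k := h v - h u) h1 (fun r hr hr1 => by
    have h3 := hconv.2 (mem_univ u) (mem_univ v) (sub_nonneg.2 hr1) hr.le (by ring)
    have e : (1 - r) • u + r • v = u + r • (v - u) := by module
    rw [e] at h3
    simp only [smul_eq_mul, zero_smul, add_zero] at h3 ⊢
    linarith)
  linarith

theorem le_add_inner_gradient_add {h : E → ℝ} (hdiff : Differentiable ℝ h) {L : ℝ}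
    (hgrad : ∀ u v : E, ‖∇ h u - ∇ h v‖ ≤ L * ‖u - v‖) (u d : E) :
    h (u + d) ≤ h u + inner ℝ (∇ h u) d + L / 2 * ‖d‖ ^ 2 := by
  have hd : ∀ t, HasDerivAt
      (fun r : ℝ => h (u + r • d) - r * inner ℝ (∇ h u) d - r ^ 2 * (L / 2 * ‖d‖ ^ 2))
      (inner ℝ (∇ h (u + t • d)) d - inner ℝ (∇ h u) d - t * (L * ‖d‖ ^ 2)) t := fun t => by
    have h1 := ((hasDerivAt_line hdiff u d t).sub
      ((hasDerivAt_id t).mul_const (inner ℝ (∇ h u) d))).sub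
      ((hasDerivAt_pow 2 t).mul_const (L / 2 * ‖d‖ ^ 2))
    refine h1.congr_deriv ?_
    simp; ring
  have hanti := antitoneOn_of_deriv_nonpos (convex_Icc (0 : ℝ) 1)
    (fun t _ => (hd t).continuousAt.continuousWithinAt)
    (fun t _ => (hd t).differentiableAt.differentiableWithinAt) (fun t ht => by
      rw [(hd t).deriv, ← inner_sub_left]
      rw [interior_Icc] at ht
      have h1 := hgrad (u + t • d) u
      rw [add_sub_cancel_left, norm_smul, Real.norm_of_nonneg ht.1.le] at h1
      have h2 := (real_inner_le_norm (∇ h (u + t • d) - ∇ h u) d).trans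
        (mul_le_mul_of_nonneg_right h1 (norm_nonneg d))
      nlinarith)
  have := hanti (left_mem_Icc.2 zero_le_one) (right_mem_Icc.2 zero_le_one) zero_le_one
  simp only [one_smul, zero_smul, add_zero] at this
  linarith

/-- A form of the Baillon–Haddad theorem. -/
theorem neg_inner_gradient_sub_le {h : E → ℝ} (hconv : ConvexOn ℝ Set.univ h)
    (hdiff : Differentiable ℝ h) {L : ℝ}
    (hgrad : ∀ u v : E, ‖∇ h u - ∇ h v‖ ≤ L * ‖u - v‖) (u v d : E) :
    -inner ℝ (∇ h u - ∇ h v) (u - v + d) ≤ L / 4 * ‖d‖ ^ 2 := by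
  -- The displacement d is split evenly between u and v. Each half costs (L/2)‖d/2‖² = (L/8)‖d‖²,
  -- and the two convexity inequalities at the displaced points cancel the function values.
  have h1 := le_add_inner_gradient_add hdiff hgrad u ((1 / 2 : ℝ) • d)
  have h2 := le_add_inner_gradient_add hdiff hgrad v (-((1 / 2 : ℝ) • d))
  have h3 := add_inner_gradient_le hconv hdiff v (u + (1 / 2 : ℝ) • d)
  have h4 := add_inner_gradient_le hconv hdiff u (v + -((1 / 2 : ℝ) • d))
  simp only [norm_neg, norm_smul, inner_add_right, inner_sub_right, inner_neg_right,
    inner_sub_left, inner_smul_right] at *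
  norm_num at *
  nlinarith

end SmoothConvex

/-! ### Decreasing families of positive operators. -/

section PositiveOperators

variable {E : Type*} [NormedAddCommGroup E] [InnerProductSpace ℝ E]

theorem norm_sq_apply_le_of_isPositive {P : E →L[ℝ] E} (hP : P.IsPositive) {K : ℝ} (hK : 0 < K)
    (hPK : ∀ w, inner ℝ w (P w) ≤ K * ‖w‖ ^ 2) (d : E) :
    ‖P d‖ ^ 2 ≤ K * inner ℝ d (P d) := by
  -- Positivity at d - K⁻¹Pd gives 0 ≤ ⟨d, Pd⟩ - 2K⁻¹‖Pd‖² + K⁻²⟨Pd, P(Pd)⟩, and the last term is at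
  -- most K⁻¹‖Pd‖².
  have h0 := hP.inner_nonneg_right (d - K⁻¹ • P d)
  have h1 := hPK (P d)
  have hs : inner ℝ (P d) (P d) = ‖P d‖ ^ 2 := real_inner_self_eq_norm_sq _
  have hs' : inner ℝ d (P (P d)) = ‖P d‖ ^ 2 := by
    rw [← hP.inner_left_eq_inner_right, hs]
  simp only [map_sub, map_smul, inner_sub_left, inner_sub_right, inner_smul_left,
    inner_smul_right, hs, hs', conj_trivial] at h0
  have h2 : K⁻¹ * (K⁻¹ * inner ℝ (P d) (P (P d))) ≤ K⁻¹ * (K⁻¹ * (K * ‖P d‖ ^ 2)) := by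
    gcongr
  have h3 : K⁻¹ * (K⁻¹ * (K * ‖P d‖ ^ 2)) = K⁻¹ * ‖P d‖ ^ 2 := by field_simp
  have h4 : K⁻¹ * ‖P d‖ ^ 2 ≤ inner ℝ d (P d) := by linarith
  rwa [inv_mul_le_iff₀ hK] at h4

variable {M : ℝ → E →L[ℝ] E}

theorem inner_apply_le_opNorm (P : E →L[ℝ] E) (w : E) : inner ℝ w (P w) ≤ ‖P‖ * ‖w‖ ^ 2 := by
  have := (real_inner_le_norm w (P w)).trans
    (mul_le_mul_of_nonneg_left (P.le_opNorm w) (norm_nonneg w))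
  linarith

theorem norm_apply_le_of_opDecreasing (hM : ∀ t, 0 ≤ t → M t ∈ SPlus E) (hdec : OpDecreasing M)
    {t : ℝ} (ht : 0 ≤ t) (w : E) : ‖M t w‖ ≤ (‖M 0‖ + 1) * ‖w‖ := by
  have hK : 0 < ‖M 0‖ + 1 := by positivity
  have hb : ∀ w, inner ℝ w (M t w) ≤ (‖M 0‖ + 1) * ‖w‖ ^ 2 := fun w => by
    have := (hdec 0 t le_rfl ht w).trans (inner_apply_le_opNorm (M 0) w)
    nlinarith [sq_nonneg ‖w‖]
  have h1 := norm_sq_apply_le_of_isPositive (hM t ht) hK hb w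
  have h2 := mul_le_mul_of_nonneg_left (hb w) hK.le
  refine abs_le_of_sq_le_sq' ?_ (by positivity) |>.2
  nlinarith

theorem tendsto_inner_apply_of_opDecreasing (hM : ∀ t, 0 ≤ t → M t ∈ SPlus E)
    (hdec : OpDecreasing M) (w : E) :
    ∃ r, Tendsto (fun t => inner ℝ w (M t w)) atTop (𝓝 r) ∧
      ∀ t, 0 ≤ t → r ≤ inner ℝ w (M t w) := by
  -- Clamping at 0 extends the monotonicity from [0,∞) to the whole line.
  let q : ℝ → ℝ := fun t => inner ℝ w (M (max t 0) w)
  have hq : Antitone q := fun a b hab =>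
    hdec _ _ (le_max_right _ _) (max_le_max_right 0 hab) w
  have hbdd : BddBelow (range q) :=
    ⟨0, by rintro _ ⟨t, rfl⟩; exact (hM _ (le_max_right t 0)).inner_nonneg_right w⟩
  refine ⟨_, (tendsto_atTop_ciInf hq hbdd).congr' ?_, fun t ht => ?_⟩
  · filter_upwards [eventually_ge_atTop (0 : ℝ)] with t ht
    simp [q, max_eq_left ht]
  · simpa [q, max_eq_left ht] using ciInf_le hbdd t

/-- The quadratic forms converge, and the bound ‖Pw‖² ≤ K⟨w, Pw⟩ for the positive operator P = M N -
M t turns this into a Cauchy estimate for M t w. -/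
theorem exists_tendsto_apply_of_opDecreasing [CompleteSpace E]
    (hM : ∀ t, 0 ≤ t → M t ∈ SPlus E) (hdec : OpDecreasing M) (w : E) :
    ∃ b, Tendsto (fun t => M t w) atTop (𝓝 b) := by
  obtain ⟨r, hr, hrle⟩ := tendsto_inner_apply_of_opDecreasing hM hdec w
  set K := ‖M 0‖ + 1
  have hK : 0 < K := by positivity
  refine cauchySeq_tendsto_of_complete (Metric.cauchySeq_iff'.2 fun ε hε => ?_)
  have h1 : ∀ᶠ t in atTop, K * (inner ℝ w (M t w) - r) < ε ^ 2 := by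
    have h2 : Tendsto (fun t => K * (inner ℝ w (M t w) - r)) atTop (𝓝 (K * (r - r))) :=
      (hr.sub_const r).const_mul K
    rw [sub_self, mul_zero] at h2
    exact h2.eventually_lt_const (by positivity)
  obtain ⟨N, hN, hN0⟩ := (h1.and (eventually_ge_atTop (0 : ℝ))).exists
  refine ⟨N, fun t ht => ?_⟩
  have ht0 : 0 ≤ t := hN0.trans ht
  have hpos : (M N - M t).IsPositive := by
    refine ⟨fun u v => ?_, fun u => ?_⟩
    · have e1 := (hM N hN0).inner_left_eq_inner_right u v
      have e2 := (hM t ht0).inner_left_eq_inner_right u v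
      simp only [ContinuousLinearMap.coe_coe, _root_.sub_apply, inner_sub_left,
        inner_sub_right, e1, e2]
    · have := hdec N t hN0 ht u
      simp only [ContinuousLinearMap.reApplyInnerSelf, _root_.sub_apply,
        inner_sub_left, RCLike.re_to_real]
      rw [real_inner_comm, real_inner_comm _ (M t u)]
      linarith
  have hle := norm_sq_apply_le_of_isPositive hpos hK (fun v => by
    have e1 := (hdec 0 N le_rfl hN0 v).trans (inner_apply_le_opNorm (M 0) v)
    have e2 := (hM t ht0).inner_nonneg_right v
    simp only [_root_.sub_apply, inner_sub_right]
    nlinarith [sq_nonneg ‖v‖]) w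
  simp only [_root_.sub_apply, inner_sub_right] at hle
  have h3 := mul_le_mul_of_nonneg_left (hrle t ht0) hK.le
  rw [dist_comm, dist_eq_norm]
  refine lt_of_pow_lt_pow_left₀ 2 hε.le ?_
  nlinarith

end PositiveOperators

/-! ### Weak limits along filters and ultrafilters. -/

section WeakConvergence

variable {ι E F : Type*} [NormedAddCommGroup E] [InnerProductSpace ℝ E]
  [NormedAddCommGroup F] [InnerProductSpace ℝ F]

/-- Weak convergence of `u` to `x` along a filter. -/
def WeakTendsto (u : ι → E) (l : Filter ι) (x : E) : Prop :=
  ∀ w : E, Tendsto (fun t => inner ℝ (u t) w) l (𝓝 (inner ℝ x w))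

theorem WeakTendsto.of_sub {u v : ι → E} {l : Filter ι} {x : E} (hu : WeakTendsto u l x)
    (h : Tendsto (fun t => v t - u t) l (𝓝 0)) : WeakTendsto v l x := fun w => by
  have h1 := (hu w).add (h.inner (tendsto_const_nhds (x := w)))
  simpa [inner_sub_left] using h1

theorem WeakTendsto.map [CompleteSpace E] [CompleteSpace F] {u : ι → E} {l : Filter ι} {x : E}
    (hu : WeakTendsto u l x) (A : E →L[ℝ] F) : WeakTendsto (fun t => A (u t)) l (A x) :=
  fun w => by
    simpa [ContinuousLinearMap.adjoint_inner_right] using hu (ContinuousLinearMap.adjoint A w)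

theorem WeakTendsto.unique {u : ι → E} {l : Filter ι} [l.NeBot] {x y : E}
    (hx : WeakTendsto u l x) (hy : WeakTendsto u l y) : x = y :=
  ext_inner_right ℝ fun w => tendsto_nhds_unique (hx w) (hy w)

/-- Bounded real functions converge along an ultrafilter; the limits of ⟨u t, w⟩ form a bounded
linear functional of w, represented by a vector through Riesz. -/
theorem exists_weakTendsto [CompleteSpace E] (𝒰 : Ultrafilter ι) {u : ι → E} {C : ℝ}
    (hC : ∀ᶠ t in (𝒰 : Filter ι), ‖u t‖ ≤ C) : ∃ x, WeakTendsto u 𝒰 x := by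
  have h1 : ∀ w : E, ∃ r, Tendsto (fun t => inner ℝ (u t) w) 𝒰 (𝓝 r) ∧ |r| ≤ C * ‖w‖ := by
    intro w
    have h2 : (𝒰.map fun t => inner ℝ (u t) w : Filter ℝ) ≤ 𝓟 (Icc (-(C * ‖w‖)) (C * ‖w‖)) := by
      rw [Ultrafilter.coe_map, le_principal_iff, mem_map]
      filter_upwards [hC] with t ht
      refine abs_le.1 ((abs_real_inner_le_norm _ _).trans ?_)
      gcongr
    obtain ⟨r, hr, hle⟩ := isCompact_Icc.ultrafilter_le_nhds _ h2
    exact ⟨r, hle, abs_le.2 hr⟩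
  choose φ hφ hφC using h1
  let Φ : E →ₗ[ℝ] ℝ :=
    { toFun := φ
      map_add' := fun v w => tendsto_nhds_unique (hφ (v + w)) (by
        simpa only [inner_add_right] using (hφ v).add (hφ w))
      map_smul' := fun a w => tendsto_nhds_unique (hφ (a • w)) (by
        simpa only [inner_smul_right, smul_eq_mul, RingHom.id_apply] using (hφ w).const_mul a) }
  refine ⟨(InnerProductSpace.toDual ℝ E).symm (Φ.mkContinuous C hφC), fun w => ?_⟩
  rw [InnerProductSpace.toDual_symm_apply]
  exact hφ w

theorem WeakTendsto.mem_of_closed_convex [CompleteSpace E] {u : ι → E} {l : Filter ι} {x : E}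
    (hu : WeakTendsto u l x) {S : Set E} (hS : Convex ℝ S) (hcl : IsClosed S)
    (h : ∃ᶠ t in l, u t ∈ S) : x ∈ S := by
  by_contra hx
  obtain ⟨φ, r, h1, h2⟩ := geometric_hahn_banach_point_closed hS hcl hx
  have h3 := hu ((InnerProductSpace.toDual ℝ E).symm φ)
  have e : ∀ v, inner ℝ v ((InnerProductSpace.toDual ℝ E).symm φ) = φ v := fun v => by
    rw [real_inner_comm, InnerProductSpace.toDual_symm_apply]
  simp only [e] at h3
  obtain ⟨t, ht, ht'⟩ := (h.and_eventually (h3.eventually_lt_const h1)).exists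
  exact absurd (h2 _ ht) ht'.not_gt

/-- Weak lower semicontinuity: real sublevel sets are closed and convex, hence weakly closed. -/
theorem IsProperConvexLSC.eventually_lt [CompleteSpace E] {f : E → EReal}
    (hf : IsProperConvexLSC f) {u : ι → E} {l : Filter ι} {x : E} (hu : WeakTendsto u l x)
    {a : ℝ} (ha : (a : EReal) < f x) : ∀ᶠ t in l, (a : EReal) < f (u t) := by
  by_contra hn
  have hfr : ∃ᶠ t in l, u t ∈ {v | f v ≤ a} :=
    fun hE => hn (hE.mono fun t ht => not_le.1 ht)
  refine absurd (hu.mem_of_closed_convex ?_ (hf.lowerSemicontinuous.isClosed_preimage _) hfr)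
    (not_le.2 ha)
  intro v hv w hw p q hp hq hpq
  have := hf.convex_epigraph (x := (v, a)) hv (y := (w, a)) hw hp hq hpq
  simpa [← add_mul, hpq] using this

end WeakConvergence

/-! ### Saddle points and the optimality system. -/

section SaddlePoints

variable {H G : Type*} [NormedAddCommGroup H] [InnerProductSpace ℝ H]
  [NormedAddCommGroup G] [InnerProductSpace ℝ G]

theorem inner_sub_nonneg_of_mem_subdifferential {f : H → EReal} {x x' u u' : H}
    (hu : u ∈ subdifferential f x) (hu' : u' ∈ subdifferential f x') :
    0 ≤ inner ℝ (u - u') (x - x') := by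
  obtain ⟨h1, h2, h3⟩ := hu
  obtain ⟨h1', h2', h3'⟩ := hu'
  have e := h3 x'
  have e' := h3' x
  lift f x to ℝ using ⟨h2, h1⟩ with a
  lift f x' to ℝ using ⟨h2', h1'⟩ with a'
  norm_cast at e e'
  simp only [inner_sub_left, inner_sub_right] at *
  linarith

theorem tendsto_inner_zero_of_bounded {ι : Type*} {l : Filter ι} {p w : ι → H} {C : ℝ}
    (hp : Tendsto p l (𝓝 0)) (hw : ∀ᶠ t in l, ‖w t‖ ≤ C) :
    Tendsto (fun t => inner ℝ (p t) (w t)) l (𝓝 0) := by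
  refine squeeze_zero_norm' (a := fun t => ‖p t‖ * C) ?_ (by simpa using hp.norm.mul_const C)
  filter_upwards [hw] with t ht
  exact (norm_inner_le_norm _ _).trans (by gcongr)

variable [CompleteSpace H] [CompleteSpace G] {f : H → EReal} {h : H → ℝ} {g : G → EReal}
  {A : H →L[ℝ] G}

theorem IsSaddlePoint.optimality (hf : IsProperConvexLSC f) (hg : IsProperConvexLSC g)
    (hdiff : Differentiable ℝ h) {x : H} {z y : G} (hs : IsSaddlePoint f h g A x z y) :
    A x = z ∧ -ContinuousLinearMap.adjoint A y - ∇ h x ∈ subdifferential f x ∧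
      y ∈ subdifferential g z := by
  obtain ⟨hmax, hmin⟩ := hs
  obtain ⟨x₁, hx₁⟩ := hf.exists_ne_top
  obtain ⟨z₁, hz₁⟩ := hg.exists_ne_top
  have hlt : lagrangian f h g A x z y < ⊤ := by
    refine (hmin x₁ z₁).trans_lt ?_
    unfold lagrangian
    lift f x₁ to ℝ using ⟨hx₁, hf.ne_bot x₁⟩ with a
    lift g z₁ to ℝ using ⟨hz₁, hg.ne_bot z₁⟩ with b
    norm_cast
    exact EReal.coe_lt_top _
  have hfx : f x ≠ ⊤ := by
    intro hx
    rw [lagrangian, hx, EReal.top_add_coe, EReal.top_add_of_ne_bot (hg.ne_bot z),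
      EReal.top_add_coe] at hlt
    exact lt_irrefl _ hlt
  have hgz : g z ≠ ⊤ := by
    intro hz
    have h1 : f x + (h x : EReal) ≠ ⊥ := by
      lift f x to ℝ using ⟨hfx, hf.ne_bot x⟩ with a
      norm_cast
      exact EReal.coe_ne_bot _
    rw [lagrangian, hz, EReal.add_top_of_ne_bot h1, EReal.top_add_coe] at hlt
    exact lt_irrefl _ hlt
  obtain ⟨a, ha⟩ : ∃ a : ℝ, f x = a := ⟨_, (EReal.coe_toReal hfx (hf.ne_bot x)).symm⟩
  obtain ⟨b, hb⟩ : ∃ b : ℝ, g z = b := ⟨_, (EReal.coe_toReal hgz (hg.ne_bot z)).symm⟩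
  have hAx : A x = z := by
    -- This choice of multiplier raises the Lagrangian by ‖Ax - z‖².
    have := hmax (y + (A x - z))
    simp only [lagrangian, ha, hb] at this
    norm_cast at this
    rw [inner_add_left] at this
    rw [real_inner_self_eq_norm_sq] at this
    rw [← sub_eq_zero, ← norm_eq_zero, ← sq_eq_zero_iff]
    exact le_antisymm (by linarith) (sq_nonneg _)
  refine ⟨hAx, ⟨hf.ne_bot x, hfx, fun x' => ?_⟩, ⟨hg.ne_bot z, hgz, fun z' => ?_⟩⟩
  · by_cases hx' : f x' = ⊤
    · rw [hx']; exact le_top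
    obtain ⟨a', ha'⟩ : ∃ a' : ℝ, f x' = a' := ⟨_, (EReal.coe_toReal hx' (hf.ne_bot x')).symm⟩
    have h1 := ((hasDerivAt_line hdiff x (x' - x) 0).add
      ((hasDerivAt_id (0 : ℝ)).mul_const (inner ℝ y (A (x' - x))))).neg
    -- Along the segment to x', f lies below its chord, so minimality bounds the difference
    -- quotients of the negated smooth part h + ⟨y, A ·⟩ by a' - a.
    have h2 := hasDerivAt_le_of_forall_sub_le (k := a' - a) h1 (fun r hr hr1 => by
      have hcv := hf.convex_epigraph (x := (x, a)) ha.le (y := (x', a')) ha'.le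
        (sub_nonneg.2 hr1) hr.le (by ring)
      have e : (1 - r) • x + r • x' = x + r • (x' - x) := by module
      simp only [mem_ofPred_eq, Prod.smul_mk, Prod.mk_add_mk, e, smul_eq_mul] at hcv
      have hm := hmin (x + r • (x' - x)) z
      have hne : f (x + r • (x' - x)) ≠ ⊤ := (hcv.trans_lt (EReal.coe_lt_top _)).ne
      obtain ⟨m, hm'⟩ : ∃ m : ℝ, f (x + r • (x' - x)) = m :=
        ⟨_, (EReal.coe_toReal hne (hf.ne_bot _)).symm⟩
      simp only [lagrangian, ha, hb, hm'] at hm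
      rw [hm'] at hcv
      norm_cast at hm hcv
      simp only [map_add, map_smul, hAx, inner_sub_right, inner_add_right, inner_smul_right,
        map_sub] at hm
      simp only [Pi.neg_apply, Pi.add_apply, id, zero_smul, add_zero, zero_mul, map_sub, hAx,
        inner_sub_right]
      linarith)
    rw [ha, ha']
    norm_cast
    simp only [zero_smul, add_zero, one_mul] at h2
    rw [inner_sub_left, inner_neg_left, ContinuousLinearMap.adjoint_inner_left]
    linarith
  · by_cases hz' : g z' = ⊤
    · rw [hz']; exact le_top
    obtain ⟨b', hb'⟩ : ∃ b' : ℝ, g z' = b' := ⟨_, (EReal.coe_toReal hz' (hg.ne_bot z')).symm⟩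
    have hm := hmin x z'
    simp only [lagrangian, ha, hb, hb'] at hm
    rw [hb, hb']
    norm_cast at hm ⊢
    simp only [hAx, inner_sub_right] at hm ⊢
    linarith

/-- Weak limits of approximate solutions of the optimality system are saddle points. -/
theorem isSaddlePoint_of_weakTendsto {ι : Type*} {l : Filter ι} [l.NeBot]
    (hf : IsProperConvexLSC f) (hg : IsProperConvexLSC g) (hconv : ConvexOn ℝ Set.univ h)
    (hdiff : Differentiable ℝ h) {x u : ι → H} {z y v : ι → G} {xl : H} {zl yl : G}
    (hu : ∀ᶠ t in l, u t ∈ subdifferential f (x t))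
    (hv : ∀ᶠ t in l, v t ∈ subdifferential g (z t))
    (hx : WeakTendsto x l xl) (hz : WeakTendsto z l zl) (hy : WeakTendsto y l yl) {C : ℝ}
    (hxC : ∀ᶠ t in l, ‖x t‖ ≤ C) (hzC : ∀ᶠ t in l, ‖z t‖ ≤ C) (hyC : ∀ᶠ t in l, ‖y t‖ ≤ C)
    (hp : Tendsto (fun t => u t + ∇ h (x t) + ContinuousLinearMap.adjoint A (y t)) l (𝓝 0))
    (hq : Tendsto (fun t => v t - y t) l (𝓝 0))
    (hr : Tendsto (fun t => A (x t) - z t) l (𝓝 0)) : IsSaddlePoint f h g A xl zl yl := by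
  have hAx : A xl = zl := by
    refine ((hx.map A).of_sub (v := z) ?_).unique hz
    simpa using hr.neg
  refine ⟨fun y' => by simp [lagrangian, hAx], fun x' z' => ?_⟩
  by_cases hx' : f x' = ⊤
  · rw [lagrangian, lagrangian, hx', EReal.top_add_coe, EReal.top_add_of_ne_bot (hg.ne_bot z'),
      EReal.top_add_coe]
    exact le_top
  obtain ⟨a', ha'⟩ : ∃ a' : ℝ, f x' = a' := ⟨_, (EReal.coe_toReal hx' (hf.ne_bot x')).symm⟩
  by_cases hz' : g z' = ⊤
  · have h1 : f x' + (h x' : EReal) ≠ ⊥ := by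
      rw [ha']
      norm_cast
      exact EReal.coe_ne_bot _
    rw [lagrangian, lagrangian, hz', EReal.add_top_of_ne_bot h1, EReal.top_add_coe]
    exact le_top
  obtain ⟨b', hb'⟩ : ∃ b' : ℝ, g z' = b' := ⟨_, (EReal.coe_toReal hz' (hg.ne_bot z')).symm⟩
  -- Finiteness of f xl and g zl is not yet known, so lower semicontinuity is used through real
  -- lower bounds a and b; finiteness then follows from this inequality.
  have key : ∀ a b : ℝ, (a : EReal) < f xl → (b : EReal) < g zl →
      a + h xl + b ≤ a' + h x' + b' + inner ℝ yl (A x' - z') := by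
    intro a b ha hb
    have e1 := hf.eventually_lt hx ha
    have e2 := hg.eventually_lt hz hb
    -- Products of two merely weakly convergent families occur only as ⟨A x - z, y⟩, whose first
    -- factor tends to 0 in norm. The last term comes from the affine minorant of h at xl.
    have hlim : Tendsto (fun t => a' + h x' + b' + inner ℝ (y t) (A x' - z')
        - inner ℝ (A (x t) - z t) (y t)
        - inner ℝ (u t + ∇ h (x t) + ContinuousLinearMap.adjoint A (y t)) (x' - x t)
        - inner ℝ (v t - y t) (z' - z t) - (inner ℝ (x t) (∇ h xl) - inner ℝ xl (∇ h xl))) l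
        (𝓝 (a' + h x' + b' + inner ℝ yl (A x' - z') - 0 - 0 - 0
          - (inner ℝ xl (∇ h xl) - inner ℝ xl (∇ h xl)))) := by
      refine (((((hy _).const_add _).sub (tendsto_inner_zero_of_bounded hr hyC)).sub
        (tendsto_inner_zero_of_bounded (C := ‖x'‖ + C) hp ?_)).sub
        (tendsto_inner_zero_of_bounded (C := ‖z'‖ + C) hq ?_)).sub ((hx _).sub_const _)
      · filter_upwards [hxC] with t ht
        exact (norm_sub_le _ _).trans (by gcongr)
      · filter_upwards [hzC] with t ht
        exact (norm_sub_le _ _).trans (by gcongr)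
    simp only [sub_zero, sub_self] at hlim
    refine ge_of_tendsto hlim ?_
    filter_upwards [e1, e2, hu, hv] with t h1 h2 hut hvt
    obtain ⟨_, -, h3⟩ := hut
    obtain ⟨_, -, h4⟩ := hvt
    have h5 := (add_le_add_left h1.le _).trans (h3 x')
    have h6 := (add_le_add_left h2.le _).trans (h4 z')
    rw [ha'] at h5
    rw [hb'] at h6
    norm_cast at h5 h6
    have h7 := add_inner_gradient_le hconv hdiff xl (x t)
    have h8 := add_inner_gradient_le hconv hdiff (x t) x'
    have c1 := real_inner_comm (∇ h xl) (x t)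
    have c2 := real_inner_comm (∇ h xl) xl
    have c3 := real_inner_comm (y t) (A (x t))
    have c4 := real_inner_comm (y t) (z t)
    simp only [inner_add_left, inner_sub_left, inner_sub_right,
      ContinuousLinearMap.adjoint_inner_left] at *
    linarith
  obtain ⟨a₀, -, ha₀⟩ := EReal.lt_iff_exists_real_btwn.1 (bot_lt_iff_ne_bot.2 (hf.ne_bot xl))
  obtain ⟨b₀, -, hb₀⟩ := EReal.lt_iff_exists_real_btwn.1 (bot_lt_iff_ne_bot.2 (hg.ne_bot zl))
  have hfx : f xl ≠ ⊤ := fun hx => by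
    have := key (a' + h x' + b' + inner ℝ yl (A x' - z') - h xl - b₀ + 1) b₀
      (by rw [hx]; exact EReal.coe_lt_top _) hb₀
    linarith
  have hgz : g zl ≠ ⊤ := fun hz => by
    have := key a₀ (a' + h x' + b' + inner ℝ yl (A x' - z') - h xl - a₀ + 1)
      ha₀ (by rw [hz]; exact EReal.coe_lt_top _)
    linarith
  obtain ⟨a, ha⟩ : ∃ a : ℝ, f xl = a := ⟨_, (EReal.coe_toReal hfx (hf.ne_bot xl)).symm⟩
  obtain ⟨b, hb⟩ : ∃ b : ℝ, g zl = b := ⟨_, (EReal.coe_toReal hgz (hg.ne_bot zl)).symm⟩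
  have hfin : a + h xl + b ≤ a' + h x' + b' + inner ℝ yl (A x' - z') := by
    refine le_of_forall_pos_le_add fun ε hε => ?_
    have := key (a - ε / 2) (b - ε / 2) (by rw [ha]; norm_cast; linarith)
      (by rw [hb]; norm_cast; linarith)
    linarith
  simp only [lagrangian, ha, hb, ha', hb', hAx, sub_self, inner_zero_right]
  norm_cast
  linarith

end SaddlePoints

/-! ### The pointwise dissipation estimate. -/

section Dissipation

variable {H G : Type*} [NormedAddCommGroup H] [InnerProductSpace ℝ H] [CompleteSpace H]
  [NormedAddCommGroup G] [InnerProductSpace ℝ G] [CompleteSpace G]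

/-- X, Z, Y are deviations from a saddle point and x', z', y' velocities; `hx` and `hz` are the
monotonicity of ∂f and ∂g. In their sum the Y terms reduce to -⟨Y, p⟩, where y' = cp. -/
theorem dissipation_inequality {A : H →L[ℝ] G} {c γ L : ℝ} (hc : 0 < c)
    (hγ : γ ∈ Set.Icc (0 : ℝ) 1) {P : H →L[ℝ] H} {Q : G →L[ℝ] G} (hQ : Q.IsPositive)
    {X x' Δ : H} {Z z' Y y' : G}
    (hx : 0 ≤ inner ℝ (-(P x') - ContinuousLinearMap.adjoint A (y' + Y)
      - c • ContinuousLinearMap.adjoint A z' - Δ) (X + x'))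
    (hz : 0 ≤ inner ℝ (y' + Y - (c * (1 - γ)) • A x' - Q z') (Z + z'))
    (hy : y' = c • (A X + A x' - Z - z'))
    (hΔ : -inner ℝ Δ (X + x') ≤ L / 4 * ‖x'‖ ^ 2) :
    inner ℝ X (P x') + c * (1 - γ) * inner ℝ (A X) (A x') + (inner ℝ Z (Q z') + c * inner ℝ Z z')
      + c⁻¹ * inner ℝ Y y' ≤
    -(inner ℝ x' (P x') + c * (1 - γ) / 2 * ‖A x'‖ ^ 2 - L / 4 * ‖x'‖ ^ 2)
      - (c⁻¹ * ‖y'‖ ^ 2 + c * ‖z'‖ ^ 2) / 6 := by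
  have hQz := hQ.inner_nonneg_right z'
  obtain ⟨p, hp⟩ : ∃ p, p = A X + A x' - Z - z' := ⟨_, rfl⟩
  rw [← hp] at hy
  have hZ : Z = A X + A x' - z' - p := by rw [hp]; abel
  have hy2 : c⁻¹ * ‖y'‖ ^ 2 = c * ‖p‖ ^ 2 := by
    rw [hy, norm_smul, Real.norm_of_nonneg hc.le]; field_simp
  have hy3 : c⁻¹ * inner ℝ Y y' = inner ℝ Y p := by
    rw [hy, inner_smul_right]; field_simp
  rw [hy2, hy3]
  subst hy
  simp only [inner_add_left, inner_add_right, inner_sub_left, inner_neg_left,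
    inner_smul_left, conj_trivial, map_add, ContinuousLinearMap.adjoint_inner_left] at hx hΔ
  have hZz : Z + z' = A X + A x' - p := by rw [hZ]; abel
  rw [hZz] at hz
  generalize A X = b at *
  generalize A x' = a at *
  generalize P x' = Px at *
  have hZQ : inner ℝ Z (Q z') = inner ℝ b (Q z') + inner ℝ a (Q z') - inner ℝ z' (Q z')
      - inner ℝ p (Q z') := by rw [hZ]; simp only [inner_sub_left, inner_add_left]
  have hZz' : inner ℝ Z z' = inner ℝ b z' + inner ℝ a z' - ‖z'‖ ^ 2 - inner ℝ p z' := by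
    rw [hZ, ← real_inner_self_eq_norm_sq]; simp only [inner_sub_left, inner_add_left]
  rw [hZQ, hZz']
  generalize Q z' = Qz at *
  simp only [inner_add_left, inner_add_right, inner_sub_left, inner_sub_right,
    inner_smul_left, conj_trivial, real_inner_self_eq_norm_sq] at hz
  have hγ1 : 0 ≤ 1 - γ := by linarith [hγ.2]
  -- Besides ⟨z', Qz'⟩ ≥ 0, the remaining gap is c(1-γ)(‖a‖²/2 - ⟨a, p⟩) + c⟨p, z'⟩ + (5c/6)(‖p‖² +
  -- ‖z'‖²). It equals the sum of these four terms with weights 1/2, 1/3, 1/2 and 1/12.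
  have hm1 := mul_nonneg (mul_nonneg hc.le hγ1) (sq_nonneg ‖a - p‖)
  have hm2 := mul_nonneg hc.le (sq_nonneg ‖p + (3 / 2 : ℝ) • z'‖)
  have hm3 := mul_nonneg (mul_nonneg hc.le hγ.1) (sq_nonneg ‖p‖)
  have hm4 := mul_nonneg hc.le (sq_nonneg ‖z'‖)
  rw [norm_sub_sq_real] at hm1
  rw [norm_add_sq_real, norm_smul, inner_smul_right] at hm2
  norm_num at hm2
  simp only [real_inner_comm X Px, real_inner_comm x' Px, real_inner_comm b z',
    real_inner_comm a z', real_inner_comm b Qz, real_inner_comm a Qz, real_inner_comm p Qz,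
    real_inner_comm b a, real_inner_comm b p, real_inner_comm a p] at *
  linarith

end Dissipation

/-! ### Quadratic energies with a time-dependent metric. -/

section QuadraticEnergy

variable {E : Type*} [NormedAddCommGroup E] [InnerProductSpace ℝ E]

theorem LocAbsCont.add_const {F : Type*} [NormedAddCommGroup F] [NormedSpace ℝ F] {u : ℝ → F}
    (hu : LocAbsCont u) (e : F) : LocAbsCont (fun t => u t + e) := fun T hT => by
  obtain ⟨v, hv, huv⟩ := hu T hT
  exact ⟨v, hv, fun t ht => by simp only [huv t ht]; abel⟩

theorem locAbsCont_const {F : Type*} [NormedAddCommGroup F] [NormedSpace ℝ F] (e : F) :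
    LocAbsCont (fun _ => e) :=
  fun _ _ => ⟨fun _ => 0, integrableOn_zero, fun _ _ => by simp⟩

/-- The squared distance from `U t` to `p`, measured by the operator `S t`. -/
noncomputable def quadEnergy (S : ℝ → E →L[ℝ] E) (U : ℝ → E) (p : E) (t : ℝ) : ℝ :=
  inner ℝ (U t - p) (S t (U t - p))

variable {S : ℝ → E →L[ℝ] E} {U : ℝ → E}

theorem absolutelyContinuousOnInterval_quadEnergy (hS : LocAbsCont S) (hU : LocAbsCont U) (p : E)
    {T : ℝ} (hT : 0 < T) : AbsolutelyContinuousOnInterval (quadEnergy S U p) 0 T := by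
  have h1 : AbsolutelyContinuousOnInterval (fun t => U t - p) 0 T := by
    simpa only [sub_eq_add_neg] using (hU.add_const (-p)).absolutelyContinuousOnInterval hT
  exact h1.bilinear (innerSL ℝ) ((hS.absolutelyContinuousOnInterval hT).bilinear
    (ContinuousLinearMap.id ℝ (E →L[ℝ] E)) h1)

theorem inner_deriv_nonpos_of_opDecreasing (hdec : OpDecreasing S) {S' : E →L[ℝ] E} {t : ℝ}
    (ht : 0 ≤ t) (hS : HasDerivAt S S' t) (w : E) : inner ℝ w (S' w) ≤ 0 := by
  have h1 : HasDerivAt (fun r => inner ℝ w (S r w)) (inner ℝ w (S' w)) t := by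
    simpa using (hasDerivAt_const t w).inner ℝ (hS.clm_apply (hasDerivAt_const t w))
  have h2 := (hasDerivAt_iff_tendsto_slope_zero.1 h1).mono_left (nhdsGT_le_nhdsNE (0 : ℝ))
  refine le_of_tendsto h2 ?_
  filter_upwards [self_mem_nhdsWithin] with r hr
  have hr : 0 < r := hr
  rw [smul_eq_mul]
  exact mul_nonpos_of_nonneg_of_nonpos (inv_pos.2 hr).le
    (sub_nonpos.2 (hdec t (t + r) ht (by linarith) w))

/-- By the product rule the only other contribution is ⟨U - p, S'(U - p)⟩, nonpositive because S
decreases. -/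
theorem ae_deriv_quadEnergy_le [CompleteSpace E] (hS : LocAbsCont S) (hU : LocAbsCont U)
    (hpos : ∀ t, 0 ≤ t → S t ∈ SPlus E) (hdec : OpDecreasing S) (p : E) :
    ∀ᵐ t ∂(volume.restrict (Ici (0 : ℝ))), DifferentiableAt ℝ (quadEnergy S U p) t ∧
      deriv (quadEnergy S U p) t ≤ 2 * inner ℝ (U t - p) (S t (deriv U t)) := by
  filter_upwards [hS.ae_hasDerivAt, hU.ae_hasDerivAt, ae_restrict_mem measurableSet_Ici]
    with t h1 h2 ht
  have h3 := h2.sub_const p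
  have h4 : HasDerivAt (quadEnergy S U p) _ t := h3.inner ℝ (h1.clm_apply h3)
  refine ⟨h4.differentiableAt, ?_⟩
  rw [h4.deriv, inner_add_right]
  have h5 := inner_deriv_nonpos_of_opDecreasing hdec ht h1 (U t - p)
  have h6 := (hpos t ht).inner_left_eq_inner_right (deriv U t) (U t - p)
  rw [← h6, real_inner_comm (U t - p) (S t (deriv U t))]
  linarith

/-- Along filters on which `U` converges weakly, the difference of two energies has a limit that
is strictly smaller at the first of the two reference points. -/
theorem exists_limit_quadEnergy_sub [CompleteSpace E] (hpos : ∀ t, 0 ≤ t → S t ∈ SPlus E)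
    (hdec : OpDecreasing S) {β : ℝ} (hβ : ∀ t, 0 ≤ t → ∀ w, β * ‖w‖ ^ 2 ≤ inner ℝ w (S t w))
    (U : ℝ → E) (p q : E) :
    ∃ ℓ : E → ℝ, (∀ (l : Filter ℝ) (C : ℝ) (a : E), l ≤ atTop → (∀ᶠ t in l, ‖U t‖ ≤ C) →
      WeakTendsto U l a →
        Tendsto (fun t => quadEnergy S U p t - quadEnergy S U q t) l (𝓝 (ℓ a))) ∧
      ℓ p + 2 * β * ‖p - q‖ ^ 2 ≤ ℓ q := by
  obtain ⟨b, hb⟩ := exists_tendsto_apply_of_opDecreasing hpos hdec (p - q)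
  obtain ⟨rp, hrp, -⟩ := tendsto_inner_apply_of_opDecreasing hpos hdec p
  obtain ⟨rq, hrq, -⟩ := tendsto_inner_apply_of_opDecreasing hpos hdec q
  -- The terms quadratic in U cancel, leaving -2⟨U, S(p - q)⟩ + ⟨p, Sp⟩ - ⟨q, Sq⟩. Strong
  -- convergence of S(p - q) to b lets the pairing with the weakly convergent U pass to the limit.
  refine ⟨fun a => -2 * inner ℝ a b + (rp - rq), fun l C a hl hC ha => ?_, ?_⟩
  · have h1 : Tendsto (fun t => S t (p - q) - b) l (𝓝 0) := by
      simpa using (hb.mono_left hl).sub_const b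
    have h2 := (ha b).add (tendsto_inner_zero_of_bounded h1 hC)
    rw [add_zero] at h2
    refine ((h2.const_mul (-2)).add ((hrp.mono_left hl).sub (hrq.mono_left hl))).congr' ?_
    filter_upwards [hl (eventually_ge_atTop (0 : ℝ))] with t ht
    have e1 := (hpos t ht).inner_left_eq_inner_right (U t) p
    have e2 := (hpos t ht).inner_left_eq_inner_right (U t) q
    have c1 := real_inner_comm (U t) (S t p)
    have c2 := real_inner_comm (U t) (S t q)
    have c3 := real_inner_comm (S t (U t)) p
    have c4 := real_inner_comm (S t (U t)) q
    have c5 := real_inner_comm (U t) b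
    simp only [quadEnergy, map_sub, inner_sub_left, inner_sub_right]
    linarith
  · have h1 : β * ‖p - q‖ ^ 2 ≤ inner ℝ (p - q) b := by
      refine ge_of_tendsto (tendsto_const_nhds.inner hb) ?_
      filter_upwards [eventually_ge_atTop (0 : ℝ)] with t ht
      exact hβ t ht _
    rw [inner_sub_left] at h1
    show -2 * inner ℝ p b + (rp - rq) + _ ≤ -2 * inner ℝ q b + (rp - rq)
    linarith

theorem norm_le_of_quadEnergy_le {β D : ℝ} (hβ : 0 < β) {p : E} {t : ℝ}
    (hS : ∀ w, β * ‖w‖ ^ 2 ≤ inner ℝ w (S t w)) (h : quadEnergy S U p t ≤ D) :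
    ‖U t‖ ≤ ‖p‖ + (D / β + 1) := by
  have h1 : ‖U t - p‖ ^ 2 ≤ D / β := by
    rw [le_div_iff₀ hβ, mul_comm]; exact (hS _).trans h
  have h2 : ‖U t‖ ≤ ‖p‖ + ‖U t - p‖ := by simpa using norm_add_le p (U t - p)
  -- The bound r ≤ r² + 1 avoids square roots.
  nlinarith [sq_nonneg (‖U t - p‖ - 1)]

theorem tendsto_zero_of_mul_norm_sq_le {F ι : Type*} [SeminormedAddCommGroup F] {l : Filter ι} {v : ι → F} {D : ι → ℝ} {δ : ℝ}
    (hδ : 0 < δ) (hD : Tendsto D l (𝓝 0)) (h : ∀ᶠ t in l, δ * ‖v t‖ ^ 2 ≤ D t) :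
    Tendsto v l (𝓝 0) := by
  have h1 : Tendsto (fun t => ‖v t‖ ^ 2) l (𝓝 0) := by
    refine squeeze_zero' (g := fun t => δ⁻¹ * D t) (Eventually.of_forall fun t => sq_nonneg _) ?_
      (by simpa using hD.const_mul δ⁻¹)
    filter_upwards [h] with t ht
    rwa [← div_eq_inv_mul, le_div_iff₀ hδ, mul_comm]
  rw [tendsto_zero_iff_norm_tendsto_zero]
  simpa [Real.sqrt_sq] using h1.sqrt

theorem tendsto_apply_zero_of_norm_le {F F' ι : Type*} [SeminormedAddCommGroup F]
    [SeminormedAddCommGroup F'] {l : Filter ι} {v : ι → F'} {w : ι → F} {K : ℝ} (hv : Tendsto v l (𝓝 0))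
    (h : ∀ᶠ t in l, ‖w t‖ ≤ K * ‖v t‖) : Tendsto w l (𝓝 0) :=
  squeeze_zero_norm' h (by simpa using hv.norm.const_mul K)

end QuadraticEnergy

/-! ### The system in velocity form, and weak convergence in the product. -/

section System

variable {H G : Type*} [NormedAddCommGroup H] [InnerProductSpace ℝ H] [CompleteSpace H]
  [NormedAddCommGroup G] [InnerProductSpace ℝ G] [CompleteSpace G]

/-- Inserting the equation for y' absorbs the penalty terms cA*A and cI. The inclusions become the
optimality system at the point (x + x', z + z', y) up to terms controlled by the velocities. -/
theorem IsStrongGlobalSolution.ae_inclusions {f : H → EReal} {h : H → ℝ} {g : G → EReal}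
    {A : H →L[ℝ] G} {c γ : ℝ} {M₁ : ℝ → H →L[ℝ] H} {M₂ : ℝ → G →L[ℝ] G} {x₀ : H} {z₀ y₀ : G}
    {x : ℝ → H} {z y : ℝ → G} (hsol : IsStrongGlobalSolution f h g A c γ M₁ M₂ x₀ z₀ y₀ x z y) :
    ∀ᵐ t ∂(volume.restrict (Ici (0 : ℝ))),
      (-(M₁ t (deriv x t)) - ContinuousLinearMap.adjoint A (deriv y t + y t)
        - c • ContinuousLinearMap.adjoint A (deriv z t) - ∇ h (x t)
          ∈ subdifferential f (x t + deriv x t)) ∧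
      (deriv y t + y t - (c * (1 - γ)) • A (deriv x t) - M₂ t (deriv z t)
          ∈ subdifferential g (z t + deriv z t)) ∧
      deriv y t = c • (A (x t + deriv x t) - (z t + deriv z t)) := by
  filter_upwards [hsol.eq_x, hsol.eq_z, hsol.eq_y] with t hx hz hy
  rw [← smul_sub] at hy
  refine ⟨?_, ?_, hy⟩
  · obtain ⟨u, hu, w, hw, hv⟩ := Set.mem_add.1 hx
    rw [mem_singleton_iff.1 hw] at hv
    rw [add_comm (x t)]
    convert hu using 1
    rw [← eq_sub_iff_add_eq] at hv
    rw [hv, hy]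
    simp only [map_add, map_sub, map_smul]
    module
  · obtain ⟨u, hu, w, hw, hv⟩ := Set.mem_add.1 hz
    rw [mem_singleton_iff.1 hw] at hv
    rw [add_comm (z t)]
    convert hu using 1
    rw [← eq_sub_iff_add_eq] at hv
    rw [hv, hy]
    simp only [map_add, map_smul]
    module

theorem WeakTendsto.tendsto_apply {ι : Type*} {l : Filter ι} {x : ι → H} {a : H}
    (hx : WeakTendsto x l a) (φ : H →L[ℝ] ℝ) : Tendsto (fun t => φ (x t)) l (𝓝 (φ a)) := by
  have e : ∀ v, inner ℝ v ((InnerProductSpace.toDual ℝ H).symm φ) = φ v := fun v => by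
    rw [real_inner_comm, InnerProductSpace.toDual_symm_apply]
  simpa only [e] using hx ((InnerProductSpace.toDual ℝ H).symm φ)

theorem tendsto_toWeakSpace_prod {ι : Type*} {l : Filter ι} {x : ι → H} {z y : ι → G} {xl : H}
    {zl yl : G} (hx : WeakTendsto x l xl) (hz : WeakTendsto z l zl) (hy : WeakTendsto y l yl) :
    Tendsto (fun t => toWeakSpace ℝ (H × G × G) (x t, z t, y t)) l
      (𝓝 (toWeakSpace ℝ (H × G × G) (xl, zl, yl))) := by
  have hind : IsInducing (fun (a : WeakSpace ℝ (H × G × G)) (φ : (H × G × G) →L[ℝ] ℝ) =>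
      (topDualPairing ℝ (H × G × G)).flip a φ) := ⟨rfl⟩
  rw [hind.tendsto_nhds_iff, tendsto_pi_nhds]
  intro φ
  have hsplit : ∀ (a : H) (b d : G), φ (a, b, d)
      = (φ ∘L ContinuousLinearMap.inl ℝ H (G × G)) a
        + (φ ∘L ContinuousLinearMap.inr ℝ H (G × G) ∘L ContinuousLinearMap.inl ℝ G G) b
        + (φ ∘L ContinuousLinearMap.inr ℝ H (G × G) ∘L ContinuousLinearMap.inr ℝ G G) d := by
    intro a b d
    simp [← map_add]
  have h1 : Tendsto (fun t => φ (x t, z t, y t)) l (𝓝 (φ (xl, zl, yl))) := by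
    simp only [hsplit]
    exact ((hx.tendsto_apply _).add (hz.tendsto_apply _)).add (hy.tendsto_apply _)
  exact h1

end System

/-! ### The Lyapunov function and its decay. -/

section Energy

variable {H G : Type*} [NormedAddCommGroup H] [InnerProductSpace ℝ H] [CompleteSpace H]
  [NormedAddCommGroup G] [InnerProductSpace ℝ G] [CompleteSpace G]

/-- The Lyapunov function of the system attached to the point `(xs, zs, ys)`. -/
noncomputable def energy (A : H →L[ℝ] G) (c γ : ℝ) (M₁ : ℝ → H →L[ℝ] H) (M₂ : ℝ → G →L[ℝ] G)
    (x : ℝ → H) (z y : ℝ → G) (xs : H) (zs ys : G) (t : ℝ) : ℝ :=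
  quadEnergy (fun t => M₁ t + (c * (1 - γ)) • (ContinuousLinearMap.adjoint A ∘L A)) x xs t
    + quadEnergy (fun t => M₂ t + c • ContinuousLinearMap.id ℝ G) z zs t
    + quadEnergy (fun _ => c⁻¹ • ContinuousLinearMap.id ℝ G) y ys t

variable {E : Type*} [NormedAddCommGroup E] [InnerProductSpace ℝ E]

theorem OpDecreasing.add_const {M : ℝ → E →L[ℝ] E} (hM : OpDecreasing M) (P : E →L[ℝ] E) :
    OpDecreasing (fun t => M t + P) := fun t₁ t₂ h0 h1 w => by
  have := hM t₁ t₂ h0 h1 w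
  simp only [_root_.add_apply, inner_add_right]
  linarith

theorem smul_id_mem_sPlus {r : ℝ} (hr : 0 ≤ r) : r • ContinuousLinearMap.id ℝ E ∈ SPlus E :=
  ContinuousLinearMap.isPositive_id.smul_of_nonneg hr

theorem smul_adjoint_comp_self_mem_sPlus (A : H →L[ℝ] G) {r : ℝ} (hr : 0 ≤ r) :
    r • (ContinuousLinearMap.adjoint A ∘L A) ∈ SPlus H :=
  (ContinuousLinearMap.isPositive_adjoint_comp_self A).smul_of_nonneg hr

theorem inner_smul_adjoint_comp_self (A : H →L[ℝ] G) (r : ℝ) (v w : H) :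
    inner ℝ v ((r • (ContinuousLinearMap.adjoint A ∘L A)) w) = r * inner ℝ (A v) (A w) := by
  simp [inner_smul_right, ContinuousLinearMap.adjoint_inner_right]

variable {f : H → EReal} {h : H → ℝ} {g : G → EReal} {A : H →L[ℝ] G} {c γ L : ℝ}
  {M₁ : ℝ → H →L[ℝ] H} {M₂ : ℝ → G →L[ℝ] G} {x₀ : H} {z₀ y₀ : G} {x : ℝ → H} {z y : ℝ → G}

theorem absolutelyContinuousOnInterval_energy (hM₁ac : LocAbsCont M₁) (hM₂ac : LocAbsCont M₂)
    (hsol : IsStrongGlobalSolution f h g A c γ M₁ M₂ x₀ z₀ y₀ x z y) (xs : H) (zs ys : G)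
    {T : ℝ} (hT : 0 < T) :
    AbsolutelyContinuousOnInterval (energy A c γ M₁ M₂ x z y xs zs ys) 0 T :=
  ((absolutelyContinuousOnInterval_quadEnergy (hM₁ac.add_const _) hsol.locAbsCont_x xs hT).add
    (absolutelyContinuousOnInterval_quadEnergy (hM₂ac.add_const _) hsol.locAbsCont_z zs hT)).add
    (absolutelyContinuousOnInterval_quadEnergy (locAbsCont_const _) hsol.locAbsCont_y ys hT)

theorem ae_dissipation_le_neg_deriv_energy
    (hf : IsProperConvexLSC f) (hg : IsProperConvexLSC g) (hconv : ConvexOn ℝ Set.univ h)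
    (hdiff : Differentiable ℝ h) (hgrad : ∀ u v : H, ‖∇ h u - ∇ h v‖ ≤ L * ‖u - v‖)
    (hc : 0 < c) (hγ : γ ∈ Set.Icc (0 : ℝ) 1)
    (hM₁ : ∀ t, 0 ≤ t → M₁ t ∈ SPlus H) (hM₂ : ∀ t, 0 ≤ t → M₂ t ∈ SPlus G)
    (hM₁ac : LocAbsCont M₁) (hM₂ac : LocAbsCont M₂)
    (hM₁dec : OpDecreasing M₁) (hM₂dec : OpDecreasing M₂)
    {β : ℝ} (hβ : ∀ t, 0 ≤ t → ∀ w,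
      β * ‖w‖ ^ 2 ≤ inner ℝ w (M₁ t w) + c * (1 - γ) / 2 * ‖A w‖ ^ 2 - L / 4 * ‖w‖ ^ 2)
    (hsol : IsStrongGlobalSolution f h g A c γ M₁ M₂ x₀ z₀ y₀ x z y) {xs : H} {zs ys : G}
    (hs : IsSaddlePoint f h g A xs zs ys) :
    ∀ᵐ t ∂(volume.restrict (Ici (0 : ℝ))),
      2 * (β * ‖deriv x t‖ ^ 2 + (c⁻¹ * ‖deriv y t‖ ^ 2 + c * ‖deriv z t‖ ^ 2) / 6)
        ≤ -deriv (energy A c γ M₁ M₂ x z y xs zs ys) t := by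
  obtain ⟨hAx, hfs, hgs⟩ := hs.optimality hf hg hdiff
  have hcγ : 0 ≤ c * (1 - γ) := mul_nonneg hc.le (by linarith [hγ.2])
  filter_upwards [hsol.ae_inclusions, ae_restrict_mem measurableSet_Ici,
    ae_deriv_quadEnergy_le (hM₁ac.add_const _) hsol.locAbsCont_x
      (fun t ht => (hM₁ t ht).add (smul_adjoint_comp_self_mem_sPlus A hcγ))
      (hM₁dec.add_const _) xs,
    ae_deriv_quadEnergy_le (hM₂ac.add_const _) hsol.locAbsCont_z
      (fun t ht => (hM₂ t ht).add (smul_id_mem_sPlus hc.le)) (hM₂dec.add_const _) zs,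
    ae_deriv_quadEnergy_le (locAbsCont_const (c⁻¹ • ContinuousLinearMap.id ℝ G))
      hsol.locAbsCont_y (fun t _ => smul_id_mem_sPlus (inv_pos.2 hc).le)
      (fun _ _ _ _ _ => le_rfl) ys] with t ⟨hx, hz, hy⟩ ht ⟨d1, e1⟩ ⟨d2, e2⟩ ⟨d3, e3⟩
  have hx' := inner_sub_nonneg_of_mem_subdifferential hx hfs
  have hz' := inner_sub_nonneg_of_mem_subdifferential hz hgs
  have hder : deriv (energy A c γ M₁ M₂ x z y xs zs ys) t = _ := ((d1.hasDerivAt.add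
    d2.hasDerivAt).add d3.hasDerivAt).deriv
  rw [hder]
  have hbh := neg_inner_gradient_sub_le hconv hdiff hgrad (x t) xs (deriv x t)
  have key := dissipation_inequality (A := A) (P := M₁ t) (Q := M₂ t) (X := x t - xs)
    (x' := deriv x t) (Δ := ∇ h (x t) - ∇ h xs) (Z := z t - zs) (z' := deriv z t)
    (Y := y t - ys) (y' := deriv y t) hc hγ (hM₂ t ht)
    (by
      convert hx' using 2
      · simp only [map_add, map_sub]; abel
      · abel)
    (by
      convert hz' using 2
      · abel
      · abel)
    (by rw [hy, map_sub, hAx, map_add]; congr 1; abel) hbh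
  have hb := hβ t ht (deriv x t)
  rw [_root_.add_apply, inner_add_right, inner_smul_adjoint_comp_self] at e1
  rw [_root_.add_apply, inner_add_right] at e2
  simp only [_root_.smul_apply, ContinuousLinearMap.id_apply, inner_smul_right] at e2 e3
  linarith

theorem mul_norm_sq_le_inner_smul_id (r : ℝ) (w : E) :
    r * ‖w‖ ^ 2 ≤ inner ℝ w ((r • ContinuousLinearMap.id ℝ E) w) := by
  simp [inner_smul_right]

theorem mul_norm_sq_le_inner_add_smul_id {P : E →L[ℝ] E} (hP : P ∈ SPlus E) (w : E) :
    c * ‖w‖ ^ 2 ≤ inner ℝ w ((P + c • ContinuousLinearMap.id ℝ E) w) := by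
  have h1 : 0 ≤ inner ℝ w (P w) := ContinuousLinearMap.IsPositive.inner_nonneg_right hP w
  have h2 := mul_norm_sq_le_inner_smul_id c w
  rw [_root_.add_apply, inner_add_right]
  linarith

theorem energy_nonneg_and_norm_le (hc : 0 < c) (hM₂ : ∀ t, 0 ≤ t → M₂ t ∈ SPlus G)
    {β : ℝ} (hβ0 : 0 < β) (hβ : ∀ t, 0 ≤ t → ∀ w, β * ‖w‖ ^ 2 ≤
      inner ℝ w ((M₁ t + (c * (1 - γ)) • (ContinuousLinearMap.adjoint A ∘L A)) w))
    (xs : H) (zs ys : G) {t : ℝ} (ht : 0 ≤ t) {D : ℝ}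
    (hD : energy A c γ M₁ M₂ x z y xs zs ys t ≤ D) :
    0 ≤ energy A c γ M₁ M₂ x z y xs zs ys t ∧ ‖x t‖ ≤ ‖xs‖ + (D / β + 1) ∧
      ‖z t‖ ≤ ‖zs‖ + (D / c + 1) ∧ ‖y t‖ ≤ ‖ys‖ + (D / c⁻¹ + 1) := by
  have h2 := mul_norm_sq_le_inner_add_smul_id (c := c) (hM₂ t ht)
  have h3 := mul_norm_sq_le_inner_smul_id (E := G) c⁻¹
  have hc' : 0 < c⁻¹ := inv_pos.2 hc
  have n1 : 0 ≤ quadEnergy (fun t => M₁ t + (c * (1 - γ)) • (ContinuousLinearMap.adjoint A ∘L A))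
      x xs t := (by positivity : 0 ≤ β * ‖x t - xs‖ ^ 2).trans (hβ t ht _)
  have n2 : 0 ≤ quadEnergy (fun t => M₂ t + c • ContinuousLinearMap.id ℝ G) z zs t :=
    (by positivity : 0 ≤ c * ‖z t - zs‖ ^ 2).trans (h2 _)
  have n3 : 0 ≤ quadEnergy (fun _ => c⁻¹ • ContinuousLinearMap.id ℝ G) y ys t :=
    (by positivity : 0 ≤ c⁻¹ * ‖y t - ys‖ ^ 2).trans (h3 _)
  unfold energy at hD ⊢
  exact ⟨by linarith, norm_le_of_quadEnergy_le hβ0 (hβ t ht) (by linarith),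
    norm_le_of_quadEnergy_le (S := fun t => M₂ t + c • ContinuousLinearMap.id ℝ G) hc h2
      (by linarith),
    norm_le_of_quadEnergy_le (S := fun _ => c⁻¹ • ContinuousLinearMap.id ℝ G) hc' h3
      (by linarith)⟩

end Energy

/-! ### Cluster points, their uniqueness, and weak convergence. -/

section Convergence

variable {H G : Type*} [NormedAddCommGroup H] [InnerProductSpace ℝ H] [CompleteSpace H]
  [NormedAddCommGroup G] [InnerProductSpace ℝ G] [CompleteSpace G]
  {f : H → EReal} {h : H → ℝ} {g : G → EReal} {A : H →L[ℝ] G} {c γ L : ℝ}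
  {M₁ : ℝ → H →L[ℝ] H} {M₂ : ℝ → G →L[ℝ] G} {x₀ : H} {z₀ y₀ : G} {x : ℝ → H} {z y : ℝ → G}

theorem LocAbsCont.tendsto_comp_sub_zero {E : Type*} [NormedAddCommGroup E] [NormedSpace ℝ E]
    [CompleteSpace E] {u : ℝ → E} (hu : LocAbsCont u) {W : ℝ → ℝ} {δ : ℝ} (hδ : 0 < δ)
    (hW : ∀ᵐ t ∂(volume.restrict (Ici (0 : ℝ))), δ * ‖deriv u t‖ ^ 2 ≤ -deriv W t)
    (hanti : AntitoneOn W (Ici 0))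
    (hWac : ∀ a b, 0 ≤ a → a ≤ b → AbsolutelyContinuousOnInterval W a b)
    {l : Filter ℝ} (hl : ∀ᶠ t in l, 0 ≤ t) {s : ℝ → ℝ} (hs : ∀ t, 0 ≤ t → s t ∈ Icc t (t + 1))
    (hD : Tendsto (fun t => W t - W (t + 1)) l (𝓝 0)) :
    Tendsto (fun t => u (s t) - u t) l (𝓝 0) := by
  refine tendsto_zero_of_mul_norm_sq_le hδ hD (hl.mono fun t ht => ?_)
  obtain ⟨h1, h2⟩ := hs t ht
  refine (hu.norm_sub_sq_le hδ hW ht h1 h2 (hWac _ _ ht h1)).trans ?_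
  have := hanti (mem_Ici.2 (ht.trans h1)) (mem_Ici.2 (by linarith)) h2
  linarith

/-- Weak cluster points of the trajectory are saddle points, provided the velocities satisfy a
dissipation inequality with a convergent Lyapunov function. -/
theorem isSaddlePoint_of_dissipation
    (hf : IsProperConvexLSC f) (hg : IsProperConvexLSC g) (hconv : ConvexOn ℝ Set.univ h)
    (hdiff : Differentiable ℝ h) (hgrad : ∀ u v : H, ‖∇ h u - ∇ h v‖ ≤ L * ‖u - v‖)
    (hc : 0 < c)
    (hM₁ : ∀ t, 0 ≤ t → M₁ t ∈ SPlus H) (hM₂ : ∀ t, 0 ≤ t → M₂ t ∈ SPlus G)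
    (hM₁dec : OpDecreasing M₁) (hM₂dec : OpDecreasing M₂)
    (hsol : IsStrongGlobalSolution f h g A c γ M₁ M₂ x₀ z₀ y₀ x z y)
    {W : ℝ → ℝ} (hWac : ∀ T, 0 < T → AbsolutelyContinuousOnInterval W 0 T) {w δ : ℝ}
    (hWlim : Tendsto W atTop (𝓝 w)) (hδ : 0 < δ)
    (hW : ∀ᵐ t ∂(volume.restrict (Ici (0 : ℝ))),
      δ * ‖deriv x t‖ ^ 2 ≤ -deriv W t ∧ δ * ‖deriv z t‖ ^ 2 ≤ -deriv W t ∧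
        δ * ‖deriv y t‖ ^ 2 ≤ -deriv W t)
    {C : ℝ} (hC : ∀ t, 0 ≤ t → ‖x t‖ ≤ C ∧ ‖z t‖ ≤ C ∧ ‖y t‖ ≤ C)
    {l : Filter ℝ} [l.NeBot] (hl : l ≤ atTop) {xl : H} {zl yl : G}
    (hx : WeakTendsto x l xl) (hz : WeakTendsto z l zl) (hy : WeakTendsto y l yl) :
    IsSaddlePoint f h g A xl zl yl := by
  have hWac' : ∀ a b, 0 ≤ a → a ≤ b → AbsolutelyContinuousOnInterval W a b := fun a b ha hab =>
    (hWac (b + 1) (by linarith)).mono (by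
      rw [uIcc_of_le hab, uIcc_of_le (by linarith)]; exact Icc_subset_Icc ha (by linarith))
  have hanti : AntitoneOn W (Ici 0) := antitoneOn_of_ae_deriv_nonpos hWac (by
    filter_upwards [hW] with t ht
    have : 0 ≤ δ * ‖deriv x t‖ ^ 2 := by positivity
    linarith [ht.1])
  -- Velocities are controlled only at selected times s t within [t, t+1], where the inclusions hold
  -- too. The increments between t and s t vanish in the limit, so weak limits are unaffected.
  choose! s hs hsP hsW using fun t (ht : (0 : ℝ) ≤ t) =>
    exists_mem_Icc_neg_deriv_le (hsol.ae_inclusions.and hW) ht (hWac' t (t + 1) ht (by linarith))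
  have hD : Tendsto (fun t => W t - W (t + 1)) l (𝓝 0) := by
    have := hWlim.sub (hWlim.comp (tendsto_atTop_add_const_right atTop (1 : ℝ) tendsto_id))
    rw [sub_self] at this
    exact this.mono_left hl
  have h0 : ∀ᶠ t in l, 0 ≤ t := hl (eventually_ge_atTop 0)
  have hsP' : ∀ᶠ t in l, 0 ≤ s t ∧ δ * ‖deriv x (s t)‖ ^ 2 ≤ W t - W (t + 1) ∧
      δ * ‖deriv z (s t)‖ ^ 2 ≤ W t - W (t + 1) ∧ δ * ‖deriv y (s t)‖ ^ 2 ≤ W t - W (t + 1) := by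
    filter_upwards [h0] with t ht
    obtain ⟨h1, h2, h3⟩ := (hsP t ht).2
    have h4 := hsW t ht
    exact ⟨ht.trans (hs t ht).1, h1.trans h4, h2.trans h4, h3.trans h4⟩
  have dx : Tendsto (fun t => deriv x (s t)) l (𝓝 0) :=
    tendsto_zero_of_mul_norm_sq_le hδ hD (hsP'.mono fun t ht => ht.2.1)
  have dz : Tendsto (fun t => deriv z (s t)) l (𝓝 0) :=
    tendsto_zero_of_mul_norm_sq_le hδ hD (hsP'.mono fun t ht => ht.2.2.1)
  have dy : Tendsto (fun t => deriv y (s t)) l (𝓝 0) :=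
    tendsto_zero_of_mul_norm_sq_le hδ hD (hsP'.mono fun t ht => ht.2.2.2)
  have sx : Tendsto (fun t => x (s t) - x t) l (𝓝 0) :=
    hsol.locAbsCont_x.tendsto_comp_sub_zero hδ (hW.mono fun t ht => ht.1) hanti hWac' h0 hs hD
  have sz : Tendsto (fun t => z (s t) - z t) l (𝓝 0) :=
    hsol.locAbsCont_z.tendsto_comp_sub_zero hδ (hW.mono fun t ht => ht.2.1) hanti hWac' h0 hs hD
  have sy : Tendsto (fun t => y (s t) - y t) l (𝓝 0) :=
    hsol.locAbsCont_y.tendsto_comp_sub_zero hδ (hW.mono fun t ht => ht.2.2) hanti hWac' h0 hs hD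
  have m1 : Tendsto (fun t => M₁ (s t) (deriv x (s t))) l (𝓝 0) :=
    tendsto_apply_zero_of_norm_le dx
      (hsP'.mono fun t ht => norm_apply_le_of_opDecreasing hM₁ hM₁dec ht.1 _)
  have m2 : Tendsto (fun t => M₂ (s t) (deriv z (s t))) l (𝓝 0) :=
    tendsto_apply_zero_of_norm_le dz
      (hsP'.mono fun t ht => norm_apply_le_of_opDecreasing hM₂ hM₂dec ht.1 _)
  have clm : ∀ {u : ℝ → G}, Tendsto u l (𝓝 0) →
      Tendsto (fun t => ContinuousLinearMap.adjoint A (u t)) l (𝓝 0) := fun hu => by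
    simpa [Function.comp_def] using ((ContinuousLinearMap.adjoint A).continuous.tendsto 0).comp hu
  have hgr : Tendsto (fun t => ∇ h (x (s t) + deriv x (s t)) - ∇ h (x (s t))) l (𝓝 0) :=
    tendsto_apply_zero_of_norm_le dx (Eventually.of_forall fun t => by
      simpa using hgrad (x (s t) + deriv x (s t)) (x (s t)))
  have hAdx : Tendsto (fun t => A (deriv x (s t))) l (𝓝 0) := by
    simpa [Function.comp_def] using (A.continuous.tendsto 0).comp dx
  have hbd : ∀ᶠ t in l, ‖x (s t) + deriv x (s t)‖ ≤ C + 1 ∧ ‖z (s t) + deriv z (s t)‖ ≤ C + 1 ∧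
      ‖y (s t)‖ ≤ C + 1 := by
    filter_upwards [hsP', dx.norm.eventually_le_const (u := 1) (by simp),
      dz.norm.eventually_le_const (u := 1) (by simp)] with t ht h1 h2
    obtain ⟨c1, c2, c3⟩ := hC (s t) ht.1
    exact ⟨(norm_add_le _ _).trans (by gcongr), (norm_add_le _ _).trans (by gcongr), by linarith⟩
  refine isSaddlePoint_of_weakTendsto (l := l) (C := C + 1) hf hg hconv hdiff
    (x := fun t => x (s t) + deriv x (s t)) (z := fun t => z (s t) + deriv z (s t))
    (y := fun t => y (s t)) (h0.mono fun t ht => (hsP t ht).1.1)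
    (h0.mono fun t ht => (hsP t ht).1.2.1)
    (hx.of_sub ?_) (hz.of_sub ?_) (hy.of_sub sy) (hbd.mono fun t ht => ht.1)
    (hbd.mono fun t ht => ht.2.1) (hbd.mono fun t ht => ht.2.2) ?_ ?_ ?_
  · simpa [add_sub_right_comm] using sx.add dx
  · simpa [add_sub_right_comm] using sz.add dz
  · have := ((m1.neg.sub (clm dy)).sub ((clm dz).const_smul c)).add hgr
    simp only [neg_zero, sub_zero, smul_zero, add_zero] at this
    refine this.congr fun t => ?_
    rw [map_add]
    abel
  · have := (dy.sub (hAdx.const_smul (c * (1 - γ)))).sub m2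
    simp only [sub_zero, smul_zero] at this
    refine this.congr fun t => ?_
    abel
  · have := dy.const_smul c⁻¹
    rw [smul_zero] at this
    refine this.congr' ?_
    filter_upwards [h0] with t ht
    rw [(hsP t ht).1.2.2, inv_smul_smul₀ hc.ne']

/-- Convergence under a uniform coercivity condition. -/
theorem exists_tendsto_of_coercive
    (hf : IsProperConvexLSC f) (hg : IsProperConvexLSC g) (hconv : ConvexOn ℝ Set.univ h)
    (hdiff : Differentiable ℝ h) (hL : 0 ≤ L) (hgrad : ∀ u v : H, ‖∇ h u - ∇ h v‖ ≤ L * ‖u - v‖)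
    (hc : 0 < c) (hγ : γ ∈ Set.Icc (0 : ℝ) 1)
    (hM₁ : ∀ t, 0 ≤ t → M₁ t ∈ SPlus H) (hM₂ : ∀ t, 0 ≤ t → M₂ t ∈ SPlus G)
    (hsaddle : ∃ xs zs ys, IsSaddlePoint f h g A xs zs ys)
    (hM₁ac : LocAbsCont M₁) (hM₂ac : LocAbsCont M₂)
    (hM₁dec : OpDecreasing M₁) (hM₂dec : OpDecreasing M₂)
    {β : ℝ} (hβ0 : 0 < β) (hβ : ∀ t, 0 ≤ t → ∀ w,
      β * ‖w‖ ^ 2 ≤ inner ℝ w (M₁ t w) + c * (1 - γ) / 2 * ‖A w‖ ^ 2 - L / 4 * ‖w‖ ^ 2)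
    (hsol : IsStrongGlobalSolution f h g A c γ M₁ M₂ x₀ z₀ y₀ x z y) :
    ∃ xl zl yl, IsSaddlePoint f h g A xl zl yl ∧
      Tendsto (fun t : ℝ => toWeakSpace ℝ (H × G × G) (x t, z t, y t)) atTop
        (𝓝 (toWeakSpace ℝ (H × G × G) (xl, zl, yl))) := by
  have hcγ : 0 ≤ c * (1 - γ) := mul_nonneg hc.le (by linarith [hγ.2])
  -- The energy operator exceeds the dissipation operator by (c(1-γ)/2)A*A + (L/4)I, so it inherits
  -- the coercivity constant.
  have hS₁ : ∀ t, 0 ≤ t → ∀ w, β * ‖w‖ ^ 2 ≤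
      inner ℝ w ((M₁ t + (c * (1 - γ)) • (ContinuousLinearMap.adjoint A ∘L A)) w) := by
    intro t ht w
    rw [_root_.add_apply, inner_add_right, inner_smul_adjoint_comp_self,
      real_inner_self_eq_norm_sq]
    have h1 := hβ t ht w
    have h2 : 0 ≤ L / 4 * ‖w‖ ^ 2 := by positivity
    have h3 := mul_nonneg hcγ (sq_nonneg ‖A w‖)
    linarith
  set W := energy A c γ M₁ M₂ x z y with hWdef
  have hWac : ∀ xs zs ys, ∀ T, 0 < T → AbsolutelyContinuousOnInterval (W xs zs ys) 0 T :=
    fun xs zs ys T hT => absolutelyContinuousOnInterval_energy hM₁ac hM₂ac hsol xs zs ys hT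
  have hdis : ∀ {xs zs ys}, IsSaddlePoint f h g A xs zs ys →
      ∀ᵐ t ∂(volume.restrict (Ici (0 : ℝ))),
        2 * (β * ‖deriv x t‖ ^ 2 + (c⁻¹ * ‖deriv y t‖ ^ 2 + c * ‖deriv z t‖ ^ 2) / 6)
          ≤ -deriv (W xs zs ys) t := fun hs =>
    ae_dissipation_le_neg_deriv_energy hf hg hconv hdiff hgrad hc hγ hM₁ hM₂ hM₁ac hM₂ac hM₁dec
      hM₂dec hβ hsol hs
  have hanti : ∀ {xs zs ys}, IsSaddlePoint f h g A xs zs ys →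
      AntitoneOn (W xs zs ys) (Ici 0) := fun hs =>
    antitoneOn_of_ae_deriv_nonpos (hWac _ _ _) (by
      filter_upwards [hdis hs] with t ht
      have : 0 ≤ 2 * (β * ‖deriv x t‖ ^ 2
        + (c⁻¹ * ‖deriv y t‖ ^ 2 + c * ‖deriv z t‖ ^ 2) / 6) := by positivity
      linarith)
  have hlim : ∀ {xs zs ys}, IsSaddlePoint f h g A xs zs ys →
      ∃ r, Tendsto (W xs zs ys) atTop (𝓝 r) := fun {xs zs ys} hs => by
    refine ⟨_, (tendsto_atTop_ciInf (f := fun t => W xs zs ys (max t 0)) (fun a b hab =>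
      hanti hs (mem_Ici.2 (le_max_right _ _)) (mem_Ici.2 (le_max_right _ _)) (max_le_max_right 0 hab)) ⟨0, ?_⟩).congr' ?_⟩
    · rintro _ ⟨t, rfl⟩
      exact (energy_nonneg_and_norm_le hc hM₂ hβ0 hS₁ xs zs ys (le_max_right t 0) le_rfl).1
    · filter_upwards [eventually_ge_atTop (0 : ℝ)] with t ht
      rw [max_eq_left ht]
  obtain ⟨xs, zs, ys, hs⟩ := hsaddle
  obtain ⟨C, hC⟩ : ∃ C, ∀ t, 0 ≤ t → ‖x t‖ ≤ C ∧ ‖z t‖ ≤ C ∧ ‖y t‖ ≤ C := by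
    refine ⟨max (‖xs‖ + (W xs zs ys 0 / β + 1)) (max (‖zs‖ + (W xs zs ys 0 / c + 1))
      (‖ys‖ + (W xs zs ys 0 / c⁻¹ + 1))), fun t ht => ?_⟩
    obtain ⟨-, h1, h2, h3⟩ := energy_nonneg_and_norm_le hc hM₂ hβ0 hS₁ xs zs ys ht
      (hanti hs (mem_Ici.2 le_rfl) ht ht)
    exact ⟨h1.trans (le_max_left _ _), h2.trans ((le_max_left _ _).trans (le_max_right _ _)),
      h3.trans ((le_max_right _ _).trans (le_max_right _ _))⟩
  have hcluster : ∀ 𝒰 : Ultrafilter ℝ, (𝒰 : Filter ℝ) ≤ atTop → ∃ xl zl yl,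
      WeakTendsto x 𝒰 xl ∧ WeakTendsto z 𝒰 zl ∧ WeakTendsto y 𝒰 yl ∧
        IsSaddlePoint f h g A xl zl yl := by
    intro 𝒰 h𝒰
    have h0 : ∀ᶠ t in (𝒰 : Filter ℝ), 0 ≤ t := h𝒰 (eventually_ge_atTop 0)
    obtain ⟨xl, hx⟩ := exists_weakTendsto 𝒰 (h0.mono fun t ht => (hC t ht).1)
    obtain ⟨zl, hz⟩ := exists_weakTendsto 𝒰 (h0.mono fun t ht => (hC t ht).2.1)
    obtain ⟨yl, hy⟩ := exists_weakTendsto 𝒰 (h0.mono fun t ht => (hC t ht).2.2)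
    obtain ⟨r, hr⟩ := hlim hs
    have hδ : 0 < min β (min (c / 6) (c⁻¹ / 6)) := by positivity
    refine ⟨xl, zl, yl, hx, hz, hy, isSaddlePoint_of_dissipation hf hg hconv hdiff hgrad hc hM₁
      hM₂ hM₁dec hM₂dec hsol (hWac xs zs ys) hr hδ ?_ hC h𝒰 hx hz hy⟩
    filter_upwards [hdis hs] with t ht
    have p1 : 0 ≤ β * ‖deriv x t‖ ^ 2 := by positivity
    have p2 : 0 ≤ c * ‖deriv z t‖ ^ 2 := by positivity
    have p3 : 0 ≤ c⁻¹ * ‖deriv y t‖ ^ 2 := by positivity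
    refine ⟨(mul_le_mul_of_nonneg_right (min_le_left _ _) (sq_nonneg _)).trans ?_,
      (mul_le_mul_of_nonneg_right ((min_le_right _ _).trans (min_le_left _ _))
        (sq_nonneg _)).trans ?_,
      (mul_le_mul_of_nonneg_right ((min_le_right _ _).trans (min_le_right _ _))
        (sq_nonneg _)).trans ?_⟩ <;> linarith
  have hunique : ∀ {𝒰 𝒱 : Ultrafilter ℝ} {x₁ x₂ : H} {z₁ z₂ y₁ y₂ : G},
      (𝒰 : Filter ℝ) ≤ atTop → (𝒱 : Filter ℝ) ≤ atTop →
      WeakTendsto x 𝒰 x₁ → WeakTendsto z 𝒰 z₁ → WeakTendsto y 𝒰 y₁ →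
      WeakTendsto x 𝒱 x₂ → WeakTendsto z 𝒱 z₂ → WeakTendsto y 𝒱 y₂ →
      IsSaddlePoint f h g A x₁ z₁ y₁ → IsSaddlePoint f h g A x₂ z₂ y₂ →
      x₁ = x₂ ∧ z₁ = z₂ ∧ y₁ = y₂ := by
    intro 𝒰 𝒱 x₁ x₂ z₁ z₂ y₁ y₂ h𝒰 h𝒱 hx₁ hz₁ hy₁ hx₂ hz₂ hy₂ hs₁ hs₂
    obtain ⟨r₁, hr₁⟩ := hlim hs₁
    obtain ⟨r₂, hr₂⟩ := hlim hs₂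
    obtain ⟨ℓx, hℓx, hx⟩ := exists_limit_quadEnergy_sub
      (fun t ht => (hM₁ t ht).add (smul_adjoint_comp_self_mem_sPlus A hcγ))
      (hM₁dec.add_const _) hS₁ x x₁ x₂
    obtain ⟨ℓz, hℓz, hz⟩ := exists_limit_quadEnergy_sub
      (fun t ht => (hM₂ t ht).add (smul_id_mem_sPlus hc.le)) (hM₂dec.add_const _)
      (fun t ht => mul_norm_sq_le_inner_add_smul_id (c := c) (hM₂ t ht)) z z₁ z₂
    obtain ⟨ℓy, hℓy, hy⟩ := exists_limit_quadEnergy_sub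
      (S := fun _ => c⁻¹ • ContinuousLinearMap.id ℝ G)
      (fun t _ => smul_id_mem_sPlus (inv_pos.2 hc).le) (fun _ _ _ _ _ => le_rfl)
      (fun t _ => mul_norm_sq_le_inner_smul_id c⁻¹) y y₁ y₂
    -- The difference of the two energies converges along the full filter, so every cluster point
    -- yields the same value r₁ - r₂.
    have hlimit : ∀ {𝒲 : Ultrafilter ℝ} {a : H} {b d : G}, (𝒲 : Filter ℝ) ≤ atTop →
        WeakTendsto x 𝒲 a → WeakTendsto z 𝒲 b → WeakTendsto y 𝒲 d →
        ℓx a + ℓz b + ℓy d = r₁ - r₂ := by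
      intro 𝒲 a b d h𝒲 ha hb hd
      have h0 : ∀ᶠ t in (𝒲 : Filter ℝ), 0 ≤ t := h𝒲 (eventually_ge_atTop 0)
      have e1 := ((hℓx 𝒲 C a h𝒲 (h0.mono fun t ht => (hC t ht).1) ha).add
        (hℓz 𝒲 C b h𝒲 (h0.mono fun t ht => (hC t ht).2.1) hb)).add
        (hℓy 𝒲 C d h𝒲 (h0.mono fun t ht => (hC t ht).2.2) hd)
      refine tendsto_nhds_unique e1 (((hr₁.sub hr₂).mono_left h𝒲).congr fun t => ?_)
      simp only [hWdef, energy]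
      ring
    have e1 := hlimit h𝒰 hx₁ hz₁ hy₁
    have e2 := hlimit h𝒱 hx₂ hz₂ hy₂
    have hc' : 0 < c⁻¹ := inv_pos.2 hc
    have p1 : 0 ≤ β * ‖x₁ - x₂‖ ^ 2 := by positivity
    have p2 : 0 ≤ c * ‖z₁ - z₂‖ ^ 2 := by positivity
    have p3 : 0 ≤ c⁻¹ * ‖y₁ - y₂‖ ^ 2 := by positivity
    -- The sum of the three ℓ's agrees at both cluster points, yet each ℓ grows from the first to
    -- the second by at least twice a coercive square; all three squares must vanish.
    have zero : ∀ {r q : ℝ}, 0 < r → r * q ^ 2 ≤ 0 → q = 0 := fun hr hq =>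
      pow_eq_zero_iff two_ne_zero |>.1 (le_antisymm (nonpos_of_mul_nonpos_right hq hr)
        (sq_nonneg _))
    refine ⟨?_, ?_, ?_⟩ <;> rw [← sub_eq_zero, ← norm_eq_zero]
    · exact zero hβ0 (by linarith)
    · exact zero hc (by linarith)
    · exact zero hc' (by linarith)
  obtain ⟨xl, zl, yl, hx, hz, hy, hsl⟩ := hcluster (Ultrafilter.of atTop) (Ultrafilter.of_le _)
  refine ⟨xl, zl, yl, hsl, (tendsto_iff_ultrafilter _ _ _).2 fun 𝒰 h𝒰 => ?_⟩
  obtain ⟨x', z', y', hx', hz', hy', hs'⟩ := hcluster 𝒰 h𝒰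
  obtain ⟨rfl, rfl, rfl⟩ := hunique h𝒰 (Ultrafilter.of_le _) hx' hz' hy' hx hz hy hs' hsl
  exact tendsto_toWeakSpace_prod hx' hz' hy'

end Convergence

end PrimalDual

/-! ### Uniform coercivity of the dissipation operator under (I) or (II). -/

theorem theorem4p2
    {H G : Type*}
    [NormedAddCommGroup H] [InnerProductSpace ℝ H] [CompleteSpace H]
    [NormedAddCommGroup G] [InnerProductSpace ℝ G] [CompleteSpace G]
    (f : H → EReal) (hf : PrimalDual.IsProperConvexLSC f)
    (g : G → EReal) (hg : PrimalDual.IsProperConvexLSC g)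
    (h : H → ℝ) (hconv : ConvexOn ℝ Set.univ h) (hdiff : Differentiable ℝ h)
    (Lh : ℝ) (hLh : 0 ≤ Lh) (hgrad : ∀ u v : H, ‖∇ h u - ∇ h v‖ ≤ Lh * ‖u - v‖)
    (A : H →L[ℝ] G)
    (c : ℝ) (hc : 0 < c) (γ : ℝ) (hγ : γ ∈ Set.Icc (0 : ℝ) 1)
    (M₁ : ℝ → H →L[ℝ] H) (hM₁ : ∀ t : ℝ, 0 ≤ t → M₁ t ∈ PrimalDual.SPlus H)
    (M₂ : ℝ → G →L[ℝ] G) (hM₂ : ∀ t : ℝ, 0 ≤ t → M₂ t ∈ PrimalDual.SPlus G)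
    (hsaddle : ∃ (xs : H) (zs ys : G), PrimalDual.IsSaddlePoint f h g A xs zs ys)
    (hM₁ac : PrimalDual.LocAbsCont M₁) (hM₂ac : PrimalDual.LocAbsCont M₂)
    (hM₁dec : PrimalDual.OpDecreasing M₁) (hM₂dec : PrimalDual.OpDecreasing M₂)
    (hpos : ∀ t : ℝ, 0 ≤ t →
      M₁ t + (c * (1 - γ) / 4) • (ContinuousLinearMap.adjoint A ∘L A)
        - (Lh / 4) • ContinuousLinearMap.id ℝ H ∈ PrimalDual.SPlus H)
    (hM₁bd : PrimalDual.BoundedDeriv M₁) (hM₂bd : PrimalDual.BoundedDeriv M₂)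
    (hcond :
      (∃ α : ℝ, 0 < α ∧ ∀ t : ℝ, 0 ≤ t →
        M₁ t + (c * (1 - γ) / 4) • (ContinuousLinearMap.adjoint A ∘L A)
          - (Lh / 4) • ContinuousLinearMap.id ℝ H ∈ PrimalDual.PAlpha H α) ∨
      (γ < 1 ∧ ∃ α : ℝ, 0 < α ∧
        ContinuousLinearMap.adjoint A ∘L A ∈ PrimalDual.PAlpha H α))
    (x₀ : H) (z₀ y₀ : G) (x : ℝ → H) (z y : ℝ → G)
    (hsol : PrimalDual.IsStrongGlobalSolution f h g A c γ M₁ M₂ x₀ z₀ y₀ x z y) :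
    ∃ (xinf : H) (zinf yinf : G), PrimalDual.IsSaddlePoint f h g A xinf zinf yinf ∧
      Tendsto (fun t : ℝ => toWeakSpace ℝ (H × G × G) (x t, z t, y t)) atTop
        (𝓝 (toWeakSpace ℝ (H × G × G) (xinf, zinf, yinf))) := by
  have hinner : ∀ t w, inner ℝ w ((M₁ t + (c * (1 - γ) / 4) • (ContinuousLinearMap.adjoint A ∘L A)
      - (Lh / 4) • ContinuousLinearMap.id ℝ H) w)
      = inner ℝ w (M₁ t w) + c * (1 - γ) / 4 * ‖A w‖ ^ 2 - Lh / 4 * ‖w‖ ^ 2 := by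
    intro t w
    rw [_root_.sub_apply, _root_.add_apply, inner_sub_right, inner_add_right,
      PrimalDual.inner_smul_adjoint_comp_self, real_inner_self_eq_norm_sq, _root_.smul_apply,
      ContinuousLinearMap.id_apply, inner_smul_right, real_inner_self_eq_norm_sq]
  have hcγ : 0 ≤ c * (1 - γ) := mul_nonneg hc.le (by linarith [hγ.2])
  obtain ⟨β, hβ0, hβ⟩ : ∃ β : ℝ, 0 < β ∧ ∀ t, 0 ≤ t → ∀ w,
      β * ‖w‖ ^ 2 ≤ inner ℝ w (M₁ t w) + c * (1 - γ) / 2 * ‖A w‖ ^ 2 - Lh / 4 * ‖w‖ ^ 2 := by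
    rcases hcond with ⟨α, hα, h1⟩ | ⟨hγ1, α, hα, h1⟩
    · refine ⟨α, hα, fun t ht w => ?_⟩
      have h2 := (h1 t ht).2 w
      rw [hinner] at h2
      have h3 := PrimalDual.mul_norm_sq_le_inner_smul_id α w
      have h4 := mul_nonneg hcγ (sq_nonneg ‖A w‖)
      linarith
    · have hcγ' : 0 < c * (1 - γ) := mul_pos hc (by linarith)
      -- The dissipation carries c(1-γ)/2 in front of A*A: half of it makes the form in `hpos`
      -- nonnegative, and the other half supplies coercivity through A*A ≽ αI.
      refine ⟨c * (1 - γ) / 4 * α, by positivity, fun t ht w => ?_⟩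
      have h2 : 0 ≤ inner ℝ w ((M₁ t + (c * (1 - γ) / 4) • (ContinuousLinearMap.adjoint A ∘L A)
          - (Lh / 4) • ContinuousLinearMap.id ℝ H) w) :=
        ContinuousLinearMap.IsPositive.inner_nonneg_right (hpos t ht) w
      rw [hinner] at h2
      have h3 := (PrimalDual.mul_norm_sq_le_inner_smul_id α w).trans (h1.2 w)
      rw [ContinuousLinearMap.comp_apply, ContinuousLinearMap.adjoint_inner_right,
        real_inner_self_eq_norm_sq] at h3
      have h4 := mul_le_mul_of_nonneg_left h3 (show 0 ≤ c * (1 - γ) / 4 by positivity)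
      linarith
  exact PrimalDual.exists_tendsto_of_coercive hf hg hconv hdiff hLh hgrad hc hγ hM₁ hM₂ hsaddle
    hM₁ac hM₂ac hM₁dec hM₂dec hβ0 hβ hsol
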